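/- Let $\mathfrak H$ be a real separable Hilbert space and let $X=\{X(h):h\in\mathfrak H\}$ be an isonormal Gaussian process over $\mathfrak H$ on a probability space $(\Omega,\mathscr F,P)$, that is, a centered Gaussian family with $E[X(g)X(h)]=\langle g,h\rangle_{\mathfrak H}$ for all $g,h\in\mathfrak H$. We use the following notation. - $\mathfrak H^{\otimes n}$ is the $n$-th Hilbert tensor power of $\mathfrak H$, and $\mathfrak H^{\odot n}$ its subspace of symmetric elements. - For $q\ge 1$, the $q$-th Wiener chaos of $X$ is the closed linear span in $L^2(P)$ of the variables $H_q(X(h))$ with $\|h\|_{\mathfrak H}=1$, where $H_q$ is the monic Hermite polynomial of degree $q$. $J_q$ is the orthogonal projection onto it. - $I_q$ is the continuous linear map from $\mathfrak H^{\odot q}$ to $L^2(P)$ with $I_q(h^{\otimes q})=H_q(X(h))$ for $\|h\|_{\mathfrak H}=1$. - $D$ is the Malliavin derivative: the closure in $L^2(P)\times L^2(P;\mathfrak H)$ of $g(X(\phi_1),\dots,X(\phi_n))\mapsto\sum_{i=1}^n\partial_i g(X(\phi_1),\dots,X(\phi_n))\,\phi_i$, with $n\ge1$, $\phi_i\in\mathfrak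 H$ and $g\in C_c^\infty(\mathbb R^n)$. Its domain is $\mathbb D^{1,2}$. - $L^{-1}F=\sum_{q\ge1}-\frac1q J_qF$ is the inverse of the generator of the Ornstein–Uhlenbeck semigroup. - For a complete orthonormal system $(e_i)$ of $\mathfrak H$, $f\in\mathfrak H^{\odot p}$, $g\in\mathfrak H^{\odot q}$ and $0\le r\le p\wedge q$, the $r$-th contraction is $$f\otimes_r g=\sum_{i_1,\dots,i_r}\langle f,e_{i_1}\otimes\cdots\otimes e_{i_r}\rangle_{\mathfrak H^{\otimes r}}\otimes\langle g,e_{i_1}\otimes\cdots\otimes e_{i_r}\rangle_{\mathfrak H^{\otimes r}}\in\mathfrak H^{\otimes(p+q-2r)},$$ and $f\widetilde\otimes_r g$ is its canonical symmetrization. **Proposition.** Let $q\ge2$ be an integer and let $F=I_q(f)$ with $f\in\mathfrak H^{\odot q}$. Then $F$ and $L^{-1}F$ belong to $\mathbb D^{1,2}$, and almost surely $$\langle DF,-DL^{-1}F\rangle_{\mathfrak H}=q^{-1}\|DF\|_{\mathfrak H}^2 .$$ Moreover the variables $(1-\langle DF,-DL^{-1}F\rangle_{\mathfrak H})^2$ and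 $(1-q^{-1}\|DF\|_{\mathfrak H}^2)^2$ are integrable, and $$E\big[(1-\langle DF,-DL^{-1}F\rangle_{\mathfrak H})^2\big]=E\big[(1-q^{-1}\|DF\|_{\mathfrak H}^2)^2\big]$$ $$=\big(1-q!\,\|f\|_{\mathfrak H^{\otimes q}}^2\big)^2+q^2\sum_{r=1}^{q-1}(2q-2r)!\,\big((r-1)!\big)^2\binom{q-1}{r-1}^4\big\|f\widetilde\otimes_r f\big\|_{\mathfrak H^{\otimes 2(q-r)}}^2$$ $$\le\big(1-q!\,\|f\|_{\mathfrak H^{\otimes q}}^2\big)^2+q^2\sum_{r=1}^{q-1}(2q-2r)!\,\big((r-1)!\big)^2\binom{q-1}{r-1}^4\big\|f\otimes_r f\big\|_{\mathfrak H^{\otimes 2(q-r)}}^2 .$$ -/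

import Mathlib

open MeasureTheory ProbabilityTheory
open scoped Nat

namespace WienerChaos

/-! ## Hilbert tensor powers

Let `e` be a complete orthonormal system of `H` indexed by `ι`. The Hilbert tensor power `H^{⊗n}` is
realised as `ℓ²(ι^n)`: the family `f` stands for `∑ f (i₁, …, iₙ) e_{i₁} ⊗ ⋯ ⊗ e_{iₙ}`, so that the
norm of `H^{⊗n}` is the norm of `ℓ²`. The lemmas `inner_pureTensor` and `dense_span_pureTensor` below show that
this is the Hilbert tensor power: `⟨x₁ ⊗ ⋯ ⊗ xₙ, y₁ ⊗ ⋯ ⊗ yₙ⟩ = ∏ ⟨xₖ, yₖ⟩` and the elementary tensors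
span a dense subspace. -/

/-- The Hilbert tensor power `H^{⊗n}`, in the coordinates given by a complete orthonormal system of
`H` indexed by `ι`. -/
abbrev TensorPower (ι : Type*) (n : ℕ) : Type _ := lp (fun _ : Fin n → ι => ℝ) 2

theorem memℓp_two_of_summable_sq {α : Type*} {f : α → ℝ} (h : Summable fun i => f i ^ 2) :
    Memℓp f 2 := by
  refine memℓp_gen ?_
  simpa using h

theorem summable_sq {α : Type*} (f : lp (fun _ : α => ℝ) 2) : Summable fun i => f i ^ 2 := by
  have h := (lp.memℓp f).summable (by norm_num)
  simpa using h

theorem hasSum_prod_pi {ι : Type*} {n : ℕ} {a : Fin n → ι → ℝ} {A : Fin n → ℝ}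
    (h : ∀ k, HasSum (a k) (A k)) : HasSum (fun i : Fin n → ι => ∏ k, a k (i k)) (∏ k, A k) := by
  induction n with
  | zero => simp
  | succ n IH =>
    have ih := IH (fun k : Fin n => h k.succ)
    have h0 := h 0
    have hs := summable_mul_of_summable_norm h0.summable.norm ih.summable.norm
    have h1 := h0.mul ih hs
    rw [Fin.prod_univ_succ]
    refine (Equiv.hasSum_iff (Fin.consEquiv (fun _ : Fin (n + 1) => ι))).1 ?_
    have h2 : ((fun i : Fin (n + 1) → ι => ∏ k, a k (i k)) ∘ Fin.consEquiv (fun _ => ι)) =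
        fun x : ι × (Fin n → ι) => a 0 x.1 * ∏ k : Fin n, a k.succ (x.2 k) := by
      funext x
      simp [Fin.prod_univ_succ]
    rw [h2]
    exact h1

section Tensor

variable {H : Type*} [NormedAddCommGroup H] [InnerProductSpace ℝ H] {ι : Type*}

theorem hasSum_pureTensor (e : HilbertBasis ι ℝ H) {n : ℕ} (x y : Fin n → H) :
    HasSum (fun i : Fin n → ι => (∏ k, inner ℝ (e (i k)) (x k)) * ∏ k, inner ℝ (e (i k)) (y k))
      (∏ k, inner ℝ (x k) (y k)) := by
  have h := hasSum_prod_pi (fun k => e.hasSum_inner_mul_inner (x k) (y k))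
  refine h.congr_fun ?_
  intro i
  rw [← Finset.prod_mul_distrib]
  exact Finset.prod_congr rfl fun k _ => by rw [real_inner_comm]

/-- The elementary tensor `x₁ ⊗ ⋯ ⊗ xₙ`. -/
noncomputable def pureTensor (e : HilbertBasis ι ℝ H) {n : ℕ} (x : Fin n → H) : TensorPower ι n :=
  ⟨fun i => ∏ k, inner ℝ (e (i k)) (x k),
    memℓp_two_of_summable_sq (by simpa only [sq] using (hasSum_pureTensor e x x).summable)⟩

theorem pureTensor_apply (e : HilbertBasis ι ℝ H) {n : ℕ} (x : Fin n → H) (i : Fin n → ι) :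
    pureTensor e x i = ∏ k, inner ℝ (e (i k)) (x k) := rfl

theorem inner_pureTensor (e : HilbertBasis ι ℝ H) {n : ℕ} (x y : Fin n → H) :
    inner ℝ (pureTensor e x) (pureTensor e y) = ∏ k, inner ℝ (x k) (y k) := by
  rw [lp.inner_eq_tsum, ← (hasSum_pureTensor e x y).tsum_eq]
  exact tsum_congr fun i => by simp [pureTensor_apply, mul_comm]

open scoped Classical in
theorem pureTensor_basis (e : HilbertBasis ι ℝ H) {n : ℕ} (i : Fin n → ι) :
    pureTensor e (fun k => e (i k)) = lp.single 2 i (1 : ℝ) := by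
  ext j
  rw [pureTensor_apply]
  have h := orthonormal_iff_ite.1 e.orthonormal
  simp only [h]
  by_cases hij : j = i
  · subst hij
    simp
  · obtain ⟨k, hk⟩ := Function.ne_iff.1 hij
    rw [lp.single_apply_ne _ _ _ hij]
    exact Finset.prod_eq_zero (Finset.mem_univ k) (by simp [hk])

theorem dense_span_pureTensor (e : HilbertBasis ι ℝ H) (n : ℕ) :
    (Submodule.span ℝ (Set.range (pureTensor e (n := n)))).topologicalClosure = ⊤ := by
  classical
  rw [eq_top_iff]
  intro f _
  refine mem_closure_of_tendsto (lp.hasSum_single (p := 2) (by norm_num) f)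
    (Filter.Eventually.of_forall fun s => ?_)
  refine Submodule.sum_mem _ fun i _ => ?_
  have h : lp.single 2 i (f i) = f i • pureTensor e (fun k => e (i k)) := by
    rw [pureTensor_basis, ← lp.single_smul]
    simp
  rw [h]
  exact Submodule.smul_mem _ _ (Submodule.subset_span ⟨_, rfl⟩)

end Tensor

/-- The action of a permutation of the `n` tensor factors on `H^{⊗n}`. -/
def permute {ι : Type*} {n : ℕ} (σ : Equiv.Perm (Fin n)) (f : TensorPower ι n) : TensorPower ι n :=
  ⟨fun i => f (fun k => i (σ k)), memℓp_two_of_summable_sq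
    ((summable_sq f).comp_injective (i := fun (i : Fin n → ι) k => i (σ k))
      fun _ _ h => funext fun k => by simpa using congrFun h (σ.symm k))⟩

/-- Membership in the symmetric tensor power `H^{⊙n}`. -/
def IsSymmetric {ι : Type*} {n : ℕ} (f : TensorPower ι n) : Prop :=
  ∀ σ : Equiv.Perm (Fin n), permute σ f = f

/-- The canonical symmetrization of an element of `H^{⊗n}`. -/
noncomputable def symmetrize {ι : Type*} {n : ℕ} (f : TensorPower ι n) : TensorPower ι n :=
  (n ! : ℝ)⁻¹ • ∑ σ : Equiv.Perm (Fin n), permute σ f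

/-- The index `(a₁, …, a_{p-r}, s₁, …, s_r)`. -/
def joinIndex {ι : Type*} {p r : ℕ} (hp : r ≤ p) (a : Fin (p - r) → ι) (s : Fin r → ι) :
    Fin p → ι :=
  fun k => Fin.append a s (Fin.cast (Nat.sub_add_cancel hp).symm k)

theorem joinIndex_injective {ι : Type*} {p r : ℕ} (hp : r ≤ p) :
    Function.Injective fun x : (Fin (p - r) → ι) × (Fin r → ι) => joinIndex hp x.1 x.2 := by
  intro x y h
  have h' : Fin.append x.1 x.2 = Fin.append y.1 y.2 := funext fun k => by
    simpa [joinIndex] using congrFun h (Fin.cast (Nat.sub_add_cancel hp) k)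
  exact (Fin.appendEquiv (α := ι) (p - r) r).injective h'

/-- The coordinates of the `r`-th contraction: with respect to the chosen complete orthonormal
system, `f ⊗_r g = ∑_{s₁, …, s_r} ⟨f, e_{s₁} ⊗ ⋯ ⊗ e_{s_r}⟩ ⊗ ⟨g, e_{s₁} ⊗ ⋯ ⊗ e_{s_r}⟩`, the inner
products being taken in the last `r` tensor factors. -/
noncomputable def contractionCoord {ι : Type*} {p q r : ℕ} (hp : r ≤ p) (hq : r ≤ q)
    (f : TensorPower ι p) (g : TensorPower ι q) (i : Fin ((p - r) + (q - r)) → ι) : ℝ :=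
  ∑' s : Fin r → ι,
    f (joinIndex hp (fun k => i (Fin.castAdd (q - r) k)) s) *
      g (joinIndex hq (fun k => i (Fin.natAdd (p - r) k)) s)

theorem summable_sq_contractionCoord {ι : Type*} {p q r : ℕ} (hp : r ≤ p) (hq : r ≤ q)
    (f : TensorPower ι p) (g : TensorPower ι q) :
    Summable fun i => contractionCoord hp hq f g i ^ 2 := by
  have hF : Summable fun x : (Fin (p - r) → ι) × (Fin r → ι) => f (joinIndex hp x.1 x.2) ^ 2 :=
    (summable_sq f).comp_injective (joinIndex_injective hp)
  have hG : Summable fun x : (Fin (q - r) → ι) × (Fin r → ι) => g (joinIndex hq x.1 x.2) ^ 2 :=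
    (summable_sq g).comp_injective (joinIndex_injective hq)
  have hA : Summable fun a => ∑' s, f (joinIndex hp a s) ^ 2 := hF.prod
  have hB : Summable fun b => ∑' s, g (joinIndex hq b s) ^ 2 := hG.prod
  have hAB : Summable fun x : (Fin (p - r) → ι) × (Fin (q - r) → ι) =>
      (∑' s, f (joinIndex hp x.1 s) ^ 2) * ∑' s, g (joinIndex hq x.2 s) ^ 2 :=
    summable_mul_of_summable_norm hA.norm hB.norm
  rw [← (Fin.appendEquiv (α := ι) (p - r) (q - r)).summable_iff]
  refine Summable.of_nonneg_of_le (fun _ => sq_nonneg _) (fun x => ?_) hAB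
  have h1 := hF.prod_factor x.1
  have h2 := hG.prod_factor x.2
  have h : contractionCoord hp hq f g (Fin.appendEquiv (α := ι) (p - r) (q - r) x) =
      inner ℝ (⟨_, memℓp_two_of_summable_sq h2⟩ : lp (fun _ : Fin r → ι => ℝ) 2)
        (⟨_, memℓp_two_of_summable_sq h1⟩ : lp (fun _ : Fin r → ι => ℝ) 2) := by
    rw [lp.inner_eq_tsum]
    refine tsum_congr fun s => ?_
    simp [Fin.appendEquiv]
  have hn : ∀ u : lp (fun _ : Fin r → ι => ℝ) 2, ‖u‖ ^ 2 = ∑' s, u s ^ 2 := fun u => by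
    have := lp.norm_rpow_eq_tsum (p := 2) (by norm_num) u
    simpa using this
  have hcs := abs_real_inner_le_norm
    (⟨_, memℓp_two_of_summable_sq h2⟩ : lp (fun _ : Fin r → ι => ℝ) 2)
    (⟨_, memℓp_two_of_summable_sq h1⟩ : lp (fun _ : Fin r → ι => ℝ) 2)
  rw [← h] at hcs
  have hsq := pow_le_pow_left₀ (abs_nonneg _) hcs 2
  rw [sq_abs, mul_pow, hn, hn, mul_comm] at hsq
  exact hsq

/-- The `r`-th contraction `f ⊗_r g ∈ H^{⊗(p+q-2r)}` of `f ∈ H^{⊗p}` and `g ∈ H^{⊗q}`, for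
`r ≤ min p q` (and `0` for other `r`, where it is not considered). -/
noncomputable def contraction {ι : Type*} {p q : ℕ} (r : ℕ) (f : TensorPower ι p)
    (g : TensorPower ι q) : TensorPower ι ((p - r) + (q - r)) :=
  if h : r ≤ p ∧ r ≤ q then
    ⟨contractionCoord h.1 h.2 f g, memℓp_two_of_summable_sq (summable_sq_contractionCoord h.1 h.2 f g)⟩
  else 0

/-! ## Isonormal Gaussian processes, Wiener chaoses and multiple integrals -/

/-- `X = {X(h) : h ∈ H}` is an isonormal Gaussian process over `H`: a centered Gaussian family with
`E[X(g) X(h)] = ⟨g, h⟩`. -/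
structure IsIsonormal {H Ω : Type*} [NormedAddCommGroup H] [InnerProductSpace ℝ H]
    [MeasurableSpace Ω] (X : H → Ω → ℝ) (P : Measure Ω) : Prop where
  isGaussianProcess : IsGaussianProcess X P
  integral_eq_zero : ∀ h, ∫ ω, X h ω ∂P = 0
  covariance : ∀ g h, ∫ ω, X g ω * X h ω ∂P = inner ℝ g h

/-- The value at `x` of the function with graph `G` (`0` outside its domain). -/
noncomputable def graphValue {E F : Type*} [Zero F] (G : Set (E × F)) (x : E) : F :=
  open scoped Classical in if h : ∃ y, (x, y) ∈ G then h.choose else 0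

section Chaos

variable {H Ω ι : Type*} [NormedAddCommGroup H] [InnerProductSpace ℝ H] [MeasurableSpace Ω]

/-- The `q`-th Wiener chaos of `X`: the closed linear span in `L²(P)` of the variables `H_q(X(h))`,
`‖h‖ = 1`, where `H_q` is the monic (probabilists') Hermite polynomial. For `q = 0` these variables
are the constant `1`, and every `h` is admitted so that this also holds when `H = 0`. -/
noncomputable def chaos (X : H → Ω → ℝ) (P : Measure Ω) (q : ℕ) : Submodule ℝ (Lp ℝ 2 P) :=
  (Submodule.span ℝ {F : Lp ℝ 2 P | ∃ h : H, (q = 0 ∨ ‖h‖ = 1) ∧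
    F =ᵐ[P] fun ω => Polynomial.aeval (X h ω) (Polynomial.hermite q)}).topologicalClosure

noncomputable instance (X : H → Ω → ℝ) (P : Measure Ω) (q : ℕ) :
    (chaos X P q).HasOrthogonalProjection := by
  unfold chaos
  infer_instance

/-- The orthogonal projection `J_q` of `L²(P)` onto the `q`-th Wiener chaos. -/
noncomputable def chaosProj (X : H → Ω → ℝ) (P : Measure Ω) (q : ℕ) :
    Lp ℝ 2 P →L[ℝ] Lp ℝ 2 P :=
  (chaos X P q).starProjection

/-- The operator `L⁻¹ F = ∑_{q ≥ 1} -(1/q) J_q F`, the series converging in `L²(P)`. -/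
noncomputable def invGenerator (X : H → Ω → ℝ) (P : Measure Ω) (F : Lp ℝ 2 P) : Lp ℝ 2 P :=
  ∑' q : ℕ, (-(1 / ((q : ℝ) + 1))) • chaosProj X P (q + 1) F

/-- The graph of the multiple integral `I_q` of order `q`, the continuous linear map from `H^{⊙q}` to
`L²(P)` that sends `h^{⊗q}` to `H_q(X(h))` when `‖h‖ = 1`: the closed linear span of the pairs
`(h^{⊗q}, H_q(X(h)))`. -/
noncomputable def multipleIntegralGraph (e : HilbertBasis ι ℝ H) (X : H → Ω → ℝ) (P : Measure Ω)
    (q : ℕ) : Submodule ℝ (TensorPower ι q × Lp ℝ 2 P) :=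
  (Submodule.span ℝ {p : TensorPower ι q × Lp ℝ 2 P | ∃ h : H, (q = 0 ∨ ‖h‖ = 1) ∧
    p.1 = pureTensor e (fun _ => h) ∧
    p.2 =ᵐ[P] fun ω => Polynomial.aeval (X h ω) (Polynomial.hermite q)}).topologicalClosure

/-- The multiple integral `I_q(f)` of a symmetric kernel `f ∈ H^{⊙q}`. -/
noncomputable def multipleIntegral (e : HilbertBasis ι ℝ H) (X : H → Ω → ℝ) (P : Measure Ω)
    (q : ℕ) (f : TensorPower ι q) : Lp ℝ 2 P :=
  graphValue (multipleIntegralGraph e X P q : Set (TensorPower ι q × Lp ℝ 2 P)) f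

/-! ## The Malliavin derivative -/

/-- The pairs `(F, DF)` for `F` a smooth cylindrical random variable: `F = g(X(v₁), …, X(vₙ))` and
`DF = ∑ᵢ ∂ᵢg(X(v₁), …, X(vₙ)) vᵢ`, with `n ≥ 1` and `g` smooth with compact support. -/
def cylindricalPairs (X : H → Ω → ℝ) (P : Measure Ω) : Set (Lp ℝ 2 P × Lp H 2 P) :=
  {p | ∃ (n : ℕ) (v : Fin n → H) (g : (Fin n → ℝ) → ℝ),
    1 ≤ n ∧ ContDiff ℝ (⊤ : ℕ∞) g ∧ HasCompactSupport g ∧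
    (p.1 =ᵐ[P] fun ω => g fun i => X (v i) ω) ∧
    p.2 =ᵐ[P] fun ω => ∑ i, fderiv ℝ g (fun j => X (v j) ω) (Pi.single i 1) • v i}

/-- The graph of `D` on `𝔻^{1,2}`: the closure of the smooth cylindrical pairs with respect to
`(E[F²] + E[‖DF‖²])^{1/2}`, that is in `L²(P) × L²(P; H)`. -/
def malliavinGraph (X : H → Ω → ℝ) (P : Measure Ω) : Set (Lp ℝ 2 P × Lp H 2 P) :=
  closure (cylindricalPairs X P)

/-- `F` belongs to `𝔻^{1,2}`. -/
def MemD12 (X : H → Ω → ℝ) (P : Measure Ω) (F : Lp ℝ 2 P) : Prop :=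
  ∃ U : Lp H 2 P, (F, U) ∈ malliavinGraph X P

/-- The Malliavin derivative `DF ∈ L²(P; H)` of `F ∈ 𝔻^{1,2}`. -/
noncomputable def malliavinDeriv (X : H → Ω → ℝ) (P : Measure Ω) (F : Lp ℝ 2 P) : Lp H 2 P :=
  graphValue (malliavinGraph X P) F

end Chaos

end WienerChaos

/-! On the q-th chaos `invGenerator` is multiplication by -1/q, so ⟨DF, -DL⁻¹F⟩ = q⁻¹‖DF‖², and it
remains to find the chaos expansion of ‖DF‖². For F = H_q(X(h)) with ‖h‖ = 1 the derivative is q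
H_{q-1}(X(h)) h, so the polarized form of ‖DF‖² at unit vectors h, k is q²⟨h,k⟩ H_{q-1}(X(h))
H_{q-1}(X(k)). The product formula for Hermite polynomials turns this into a sum of multiple
integrals of contractions of h^{⊗q} with k^{⊗q} (`carreDuChamp_pureTensor`). Both sides are bilinear
and continuous in the kernels, and powers of unit vectors span a dense subspace of the symmetric
tensors, so the expansion holds for all symmetric kernels (`inner_deriv_eq_carreDuChamp`). Its terms
have distinct orders 2q-2r, hence are orthogonal; the constant term is read off from E‖DF‖² = q
q!‖f‖², and the isometry property of the integrals gives the other norms (`exists_ae_eq_one_sub`).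
The final inequality holds because symmetrization does not increase the norm.

The product formula is obtained algebraically. The creation operators xᵢ - Dᵢ on polynomials
commute, are adjoint to Dᵢ under the Gaussian law, and their powers applied to 1 are Hermite
polynomials when the vector is a unit vector; multiplying two such powers is an instance of the
binomial theorem (`mul_creation_pow`). Polarization identifies multiple integrals of elementary
tensors with products of creation operators (`multInt_pureTensor`).

Both I_q and D are closures of graphs. They are single valued by the isometry property and by
Gaussian integration by parts (`malliavinGraph_unique`) respectively. Values at a given symmetric
kernel exist because a norm bound on a closed graph makes its projection closed
(`exists_mem_of_mem_closure_fst`); `derivGraph` carries kernel, integral and derivative together. -/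

namespace WienerChaos

/-! ## The Wick calculus on polynomials -/

section Wick

variable {κ : Type*}

/-- The derivation of `ℝ[xⱼ]` with `xⱼ ↦ c i j`. -/
noncomputable def wickDeriv (c : κ → κ → ℝ) (i : κ) :
    Derivation ℝ (MvPolynomial κ ℝ) (MvPolynomial κ ℝ) :=
  MvPolynomial.mkDerivation ℝ fun j => MvPolynomial.C (c i j)

@[simp] theorem wickDeriv_X (c : κ → κ → ℝ) (i j : κ) :
    wickDeriv c i (MvPolynomial.X j) = MvPolynomial.C (c i j) :=
  MvPolynomial.mkDerivation_X _ _ _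

theorem wickDeriv_comm (c : κ → κ → ℝ) (i j : κ) (p : MvPolynomial κ ℝ) :
    wickDeriv c i (wickDeriv c j p) = wickDeriv c j (wickDeriv c i p) := by
  have h : ⁅wickDeriv c i, wickDeriv c j⁆ = 0 := by
    refine MvPolynomial.derivation_ext fun k => ?_
    simp [Derivation.commutator_apply]
  have := congrArg (fun D => D p) h
  simpa [Derivation.commutator_apply, sub_eq_zero] using this

/-- The creation operator `p ↦ xᵢ p - Dᵢ p`. -/
noncomputable def creation (c : κ → κ → ℝ) (i : κ) : Module.End ℝ (MvPolynomial κ ℝ) :=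
  LinearMap.mulLeft ℝ (MvPolynomial.X i) - (wickDeriv c i).toLinearMap

theorem creation_apply (c : κ → κ → ℝ) (i : κ) (p : MvPolynomial κ ℝ) :
    creation c i p = MvPolynomial.X i * p - wickDeriv c i p := rfl

/-- The two cross terms of the commutator are c j i and -c i j, which cancel by symmetry of c. -/
theorem creation_commute {c : κ → κ → ℝ} (hc : ∀ i j, c i j = c j i) (i j : κ) :
    Commute (creation c i) (creation c j) := by
  refine LinearMap.ext fun p => ?_
  simp only [Module.End.mul_apply, creation_apply, map_sub, Derivation.leibniz, wickDeriv_X,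
    smul_eq_mul, wickDeriv_comm c i j, hc i j]
  ring

theorem wickDeriv_creation (c : κ → κ → ℝ) (i j : κ) (p : MvPolynomial κ ℝ) :
    wickDeriv c i (creation c j p) = creation c j (wickDeriv c i p) + c i j • p := by
  simp only [creation_apply, map_sub, Derivation.leibniz, wickDeriv_X, smul_eq_mul,
    wickDeriv_comm c i j, MvPolynomial.smul_eq_C_mul]
  ring

theorem wickDeriv_creation_pow (c : κ → κ → ℝ) (i j : κ) (m : ℕ) :
    wickDeriv c i ((creation c j ^ m) 1) = ((m : ℝ) * c i j) • (creation c j ^ (m - 1)) 1 := by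
  induction m with
  | zero => simp
  | succ m ih =>
    rw [pow_succ', Module.End.mul_apply, wickDeriv_creation, ih, map_smul, Nat.add_sub_cancel]
    rcases m with _ | m
    · simp
    · rw [Nat.add_sub_cancel, ← Module.End.mul_apply, ← pow_succ', ← add_smul]
      push_cast
      ring_nf

theorem wickDeriv_iterate_creation_pow (c : κ → κ → ℝ) (i j : κ) (m s : ℕ) :
    ((wickDeriv c i).toLinearMap ^ s) ((creation c j ^ m) 1) =
      ((m.descFactorial s : ℝ) * c i j ^ s) • (creation c j ^ (m - s)) 1 := by
  induction s with
  | zero => simp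
  | succ s ih =>
    rw [pow_succ', Module.End.mul_apply, ih, map_smul]
    change _ • wickDeriv c i _ = _
    rw [wickDeriv_creation_pow, smul_smul, Nat.descFactorial_succ, Nat.sub_sub]
    push_cast
    ring_nf

/-- Write A for the creation operator and D for its derivation. The Leibniz rule gives p · Au = A(p
· u) + (Dp) · u, so the operator p ↦ p · A^l 1 is obtained from the identity by applying l times T ↦
AT + TD. Left multiplication by A and right multiplication by D commute, and the binomial theorem
applies to their sum. -/
theorem mul_creation_pow (c : κ → κ → ℝ) (j : κ) (l : ℕ) (p : MvPolynomial κ ℝ) :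
    p * (creation c j ^ l) 1 = ∑ s ∈ Finset.range (l + 1),
      (l.choose s : ℝ) • (creation c j ^ (l - s)) (((wickDeriv c j).toLinearMap ^ s) p) := by
  set d : Module.End ℝ (MvPolynomial κ ℝ) := (wickDeriv c j).toLinearMap with hd
  have key : ∀ (l : ℕ) (p : MvPolynomial κ ℝ), p * (creation c j ^ l) 1 =
      ((LinearMap.mulRight ℝ d + LinearMap.mulLeft ℝ (creation c j)) ^ l)
        (1 : Module.End ℝ (MvPolynomial κ ℝ)) p := by
    intro l
    induction l with
    | zero => simp
    | succ l ih =>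
      intro p
      rw [pow_succ' _ l, pow_succ' _ l, Module.End.mul_apply, Module.End.mul_apply,
        LinearMap.add_apply, LinearMap.add_apply, LinearMap.mulLeft_apply,
        LinearMap.mulRight_apply, Module.End.mul_apply, Module.End.mul_apply, ← ih, ← ih]
      simp only [hd, creation_apply, Derivation.leibniz, smul_eq_mul,
        Derivation.coeFn_coe]
      ring
  have hLR : Commute (LinearMap.mulRight ℝ d) (LinearMap.mulLeft ℝ (creation c j)) :=
    (LinearMap.commute_mulLeft_right (R := ℝ) _ _).symm
  rw [key, hLR.add_pow, LinearMap.sum_apply, LinearMap.sum_apply]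
  refine Finset.sum_congr rfl fun s _ => ?_
  simp only [LinearMap.pow_mulLeft, LinearMap.pow_mulRight, Module.End.mul_apply]
  rw [Module.End.natCast_apply, ← Nat.cast_smul_eq_nsmul ℝ]
  simp only [map_smul, LinearMap.smul_apply, LinearMap.mulLeft_apply, LinearMap.mulRight_apply,
    Module.End.mul_apply, Module.End.one_apply]

/-- The product formula for Wick powers. -/
theorem creation_pow_mul_creation_pow {c : κ → κ → ℝ} (hc : ∀ i j, c i j = c j i) (i j : κ)
    (m : ℕ) :
    (creation c i ^ m) 1 * (creation c j ^ m) 1 = ∑ s ∈ Finset.range (m + 1),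
      ((s ! : ℝ) * (m.choose s : ℝ) ^ 2 * c i j ^ s) •
        (creation c i ^ (m - s)) ((creation c j ^ (m - s)) 1) := by
  rw [mul_creation_pow]
  refine Finset.sum_congr rfl fun s _ => ?_
  rw [wickDeriv_iterate_creation_pow, map_smul, smul_smul, hc j i,
    Nat.descFactorial_eq_factorial_mul_choose, ← Module.End.mul_apply, ← Module.End.mul_apply,
    ((creation_commute hc i j).pow_pow _ _).eq]
  push_cast
  ring_nf

theorem derivation_sum_apply {R A M α : Type*} [CommSemiring R] [CommSemiring A]
    [AddCommMonoid M] [Algebra R A] [Module A M] [Module R M] (s : Finset α)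
    (D : α → Derivation R A M) (p : A) : (∑ i ∈ s, D i) p = ∑ i ∈ s, D i p := by
  classical
  induction s using Finset.induction_on with
  | empty => simp
  | insert i s hi ih => rw [Finset.sum_insert hi, Finset.sum_insert hi, Derivation.add_apply, ih]

variable [Fintype κ]

/-- The creation operator of a linear form. -/
noncomputable def creationLin (c : κ → κ → ℝ) :
    (κ → ℝ) →ₗ[ℝ] Module.End ℝ (MvPolynomial κ ℝ) :=
  Fintype.linearCombination ℝ (creation c)

theorem creationLin_apply (c : κ → κ → ℝ) (a : κ → ℝ) (p : MvPolynomial κ ℝ) :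
    creationLin c a p = (∑ i, a i • MvPolynomial.X i) * p - (∑ i, a i • wickDeriv c i) p := by
  simp [creationLin, Fintype.linearCombination_apply, LinearMap.sum_apply, creation_apply,
    smul_sub, Finset.sum_sub_distrib, Finset.sum_mul, derivation_sum_apply]

@[simp] theorem creationLin_single [DecidableEq κ] (c : κ → κ → ℝ) (i : κ) :
    creationLin c (Pi.single i 1) = creation c i := by
  simp [creationLin, Fintype.linearCombination_apply_single]

theorem creationLin_commute {c : κ → κ → ℝ} (hc : ∀ i j, c i j = c j i) (a b : κ → ℝ) :
    Commute (creationLin c a) (creationLin c b) := by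
  simp only [creationLin, Fintype.linearCombination_apply]
  exact Commute.sum_left _ _ _ fun i _ => Commute.sum_right _ _ _ fun j _ =>
    ((creation_commute hc i j).smul_left _).smul_right _

theorem sum_wickDeriv_linear (c : κ → κ → ℝ) (a : κ → ℝ) :
    (∑ i, a i • wickDeriv c i) (∑ j, a j • MvPolynomial.X j) =
      MvPolynomial.C (∑ i, ∑ j, a i * a j * c i j) := by
  rw [Finset.sum_comm, map_sum, map_sum]
  simp [derivation_sum_apply, MvPolynomial.smul_eq_C_mul, Finset.mul_sum, mul_assoc, mul_left_comm]

/-- The derivation along a sends the linear form to its variance 1, so the creation operator acts on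
polynomials in that form as u ↦ x u - u', which is the recurrence of the Hermite polynomials. -/
theorem creationLin_pow_one {c : κ → κ → ℝ} {a : κ → ℝ} (ha : ∑ i, ∑ j, a i * a j * c i j = 1)
    (n : ℕ) : (creationLin c a ^ n) 1 =
      Polynomial.aeval (∑ i, a i • MvPolynomial.X i : MvPolynomial κ ℝ) (Polynomial.hermite n) := by
  induction n with
  | zero => simp
  | succ n ih =>
    rw [pow_succ', Module.End.mul_apply, ih, creationLin_apply, Polynomial.hermite_succ, map_sub,
      map_mul, Polynomial.aeval_X]
    have h := ((∑ i, a i • wickDeriv c i).restrictScalars ℤ).map_aeval (Polynomial.hermite n)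
      (∑ i, a i • MvPolynomial.X i : MvPolynomial κ ℝ)
    rw [Derivation.restrictScalars_apply, Derivation.restrictScalars_apply,
      sum_wickDeriv_linear, ha] at h
    rw [h]
    simp

/-- Here the derivation along a is zero and creation is plain multiplication. This covers
coefficients a ≠ 0 whose combination of vectors vanishes, where no rescaling to a unit vector is
possible. -/
theorem creationLin_pow_one_of_deriv_eq_zero {c : κ → κ → ℝ} {a : κ → ℝ}
    (ha : ∀ j, ∑ i, a i * c i j = 0) (n : ℕ) :
    (creationLin c a ^ n) 1 = (∑ i, a i • MvPolynomial.X i : MvPolynomial κ ℝ) ^ n := by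
  have h0 : ∑ i, a i • wickDeriv c i = 0 := by
    refine MvPolynomial.derivation_ext fun j => ?_
    have := congrArg (MvPolynomial.C (σ := κ)) (ha j)
    simpa [derivation_sum_apply, MvPolynomial.smul_eq_C_mul] using this
  induction n with
  | zero => simp
  | succ n ih => rw [pow_succ', Module.End.mul_apply, ih, creationLin_apply, h0]; simp [pow_succ']

end Wick

/-! ## Polarization -/

/-- Adding or removing a fixed point outside A is a sign-reversing involution on the sets that
contain A. -/
theorem sum_neg_one_pow_card_superset {α : Type*} [Fintype α] [DecidableEq α] {A : Finset α}
    (hA : A ≠ Finset.univ) :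
    ∑ S : Finset α, (if A ⊆ S then (-1 : ℝ) ^ S.card else 0) = 0 := by
  obtain ⟨i, hi⟩ : ∃ i, i ∉ A := by
    by_contra! h
    exact hA (Finset.eq_univ_iff_forall.2 h)
  refine Finset.sum_involution (fun S _ => if i ∈ S then S.erase i else insert i S) ?_ ?_ ?_ ?_
  · intro S _
    by_cases hS : i ∈ S
    · have h1 : A ⊆ S.erase i ↔ A ⊆ S := by
        rw [Finset.subset_erase]
        exact and_iff_left hi
      have h2 : S.card = (S.erase i).card + 1 := (Finset.card_erase_add_one hS).symm
      simp only [hS, if_true, h1, h2]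
      split_ifs <;> ring
    · have h1 : A ⊆ insert i S ↔ A ⊆ S := Finset.subset_insert_iff_of_notMem hi
      simp only [hS, if_false, h1, Finset.card_insert_of_notMem hS]
      split_ifs <;> ring
  · intro S _ _
    by_cases hS : i ∈ S
    · simp only [hS, if_true]
      intro h
      rw [← h] at hS
      simp at hS
    · simp only [hS, if_false]
      intro h
      rw [← h] at hS
      simp at hS
  · simp
  · intro S _
    by_cases hS : i ∈ S <;> simp [hS]

/-- A symmetric multilinear map that vanishes on the diagonal is zero. -/
theorem eq_zero_of_diagonal_eq_zero {V W : Type*} [AddCommGroup V] [Module ℝ V] [AddCommGroup W]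
    [Module ℝ W] {n : ℕ} (Ψ : MultilinearMap ℝ (fun _ : Fin n => V) W)
    (hsymm : ∀ (σ : Equiv.Perm (Fin n)) (x : Fin n → V), Ψ (fun k => x (σ k)) = Ψ x)
    (hdiag : ∀ x : V, Ψ (fun _ => x) = 0) : Ψ = 0 := by
  classical
  refine MultilinearMap.ext fun x => ?_
  have h1 : ∀ S : Finset (Fin n), Ψ (fun _ => ∑ i ∈ S, x i) =
      ∑ r : Fin n → Fin n, if Finset.univ.image r ⊆ S then Ψ (fun k => x (r k)) else 0 := by
    intro S
    rw [Ψ.map_sum_finset (fun _ => x) (fun _ => S), ← Finset.sum_filter]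
    refine Finset.sum_congr ?_ fun _ _ => rfl
    ext r
    simp [Fintype.mem_piFinset, Finset.image_subset_iff]
  -- Inclusion–exclusion: this alternating sum of diagonal values is zero, while expanding each
  -- value over index maps r leaves only the surjective r, that is, the permutations.
  have h2 : ∑ S : Finset (Fin n), ((-1 : ℝ) ^ S.card) • Ψ (fun _ => ∑ i ∈ S, x i) = 0 := by
    simp [hdiag]
  simp only [h1, Finset.smul_sum] at h2
  rw [Finset.sum_comm] at h2
  have h3 : ∀ r : Fin n → Fin n, ∑ S : Finset (Fin n), ((-1 : ℝ) ^ S.card) •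
      (if Finset.univ.image r ⊆ S then Ψ (fun k => x (r k)) else 0) =
      if Function.Surjective r then ((-1 : ℝ) ^ n) • Ψ x else 0 := by
    intro r
    have h4 : ∑ S : Finset (Fin n), ((-1 : ℝ) ^ S.card) •
        (if Finset.univ.image r ⊆ S then Ψ (fun k => x (r k)) else 0) =
        (∑ S : Finset (Fin n), (if Finset.univ.image r ⊆ S then (-1 : ℝ) ^ S.card else 0)) •
          Ψ (fun k => x (r k)) := by
      rw [Finset.sum_smul]
      refine Finset.sum_congr rfl fun S _ => ?_
      split_ifs <;> simp
    rw [h4]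
    split_ifs with hr
    · have hb : Function.Bijective r := Finite.surjective_iff_bijective.1 hr
      have h5 := hsymm (Equiv.ofBijective r hb) x
      simp only [Equiv.ofBijective_apply] at h5
      rw [h5, Finset.image_univ_of_surjective hr]
      congr 1
      simp [Finset.univ_subset_iff]
    · rw [sum_neg_one_pow_card_superset, zero_smul]
      exact fun h => hr fun y => by simpa using h.ge (Finset.mem_univ y)
  rw [Finset.sum_congr rfl fun r _ => h3 r, ← Finset.sum_filter, Finset.sum_const,
    ← Nat.cast_smul_eq_nsmul ℝ, smul_smul] at h2
  -- By symmetry every permutation contributes the same vector, so the remaining scalar is their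
  -- number up to sign.
  refine (smul_eq_zero.1 h2).resolve_left (mul_ne_zero ?_ (pow_ne_zero _ (by norm_num)))
  rw [Nat.cast_ne_zero, Finset.card_ne_zero]
  exact ⟨id, by simp [Function.surjective_id]⟩

/-! ## Permutations and symmetrization -/

section Symm

variable {ι : Type*} {n : ℕ}

theorem norm_sq_eq_tsum {α : Type*} (f : lp (fun _ : α => ℝ) 2) : ‖f‖ ^ 2 = ∑' i, f i ^ 2 := by
  have := lp.norm_rpow_eq_tsum (p := 2) (by norm_num) f
  simpa using this

@[simp] theorem permute_apply (σ : Equiv.Perm (Fin n)) (f : TensorPower ι n) (i : Fin n → ι) :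
    permute σ f i = f (fun k => i (σ k)) := rfl

theorem permute_mul (σ τ : Equiv.Perm (Fin n)) (f : TensorPower ι n) :
    permute σ (permute τ f) = permute (σ * τ) f := rfl

/-- The action of a permutation on `H^{⊗n}`, as a linear isometry. -/
def permuteIsometry (σ : Equiv.Perm (Fin n)) : TensorPower ι n →ₗᵢ[ℝ] TensorPower ι n where
  toFun := permute σ
  map_add' _ _ := rfl
  map_smul' _ _ := rfl
  norm_map' f := by
    rw [← sq_eq_sq₀ (norm_nonneg _) (norm_nonneg _), norm_sq_eq_tsum, norm_sq_eq_tsum]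
    exact (Equiv.arrowCongr σ.symm (Equiv.refl ι)).tsum_eq fun i => f i ^ 2

/-- The symmetrization, as a continuous linear map. -/
noncomputable def symmetrizeL : TensorPower ι n →L[ℝ] TensorPower ι n :=
  (n ! : ℝ)⁻¹ • ∑ σ : Equiv.Perm (Fin n), (permuteIsometry σ).toContinuousLinearMap

theorem symmetrizeL_apply (f : TensorPower ι n) : symmetrizeL f = symmetrize f := by
  simp [symmetrizeL, symmetrize]
  rfl

theorem symmetrize_permute (σ : Equiv.Perm (Fin n)) (f : TensorPower ι n) :
    symmetrize (permute σ f) = symmetrize f := by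
  rw [symmetrize, symmetrize]
  congr 1
  exact Fintype.sum_equiv (Equiv.mulRight σ) _ _ fun τ => by simp [permute_mul]

theorem isSymmetric_symmetrize (f : TensorPower ι n) : IsSymmetric (symmetrize f) := by
  intro σ
  change permuteIsometry σ _ = _
  rw [symmetrize, map_smul, map_sum]
  congr 1
  exact Fintype.sum_equiv (Equiv.mulLeft σ) _ _ fun τ => by
    rw [Equiv.coe_mulLeft, ← permute_mul]; rfl

theorem symmetrize_of_isSymmetric {f : TensorPower ι n} (hf : IsSymmetric f) :
    symmetrize f = f := by
  rw [symmetrize, Finset.sum_congr rfl fun σ _ => hf σ, Finset.sum_const, Finset.card_univ,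
    Fintype.card_perm, Fintype.card_fin, ← Nat.cast_smul_eq_nsmul ℝ, smul_smul,
    inv_mul_cancel₀ (by positivity), one_smul]

/-- An average of isometries. This is the source of the inequality in the proposition. -/
theorem norm_symmetrize_le (f : TensorPower ι n) : ‖symmetrize f‖ ≤ ‖f‖ := by
  rw [symmetrize, norm_smul, Real.norm_of_nonneg (by positivity)]
  have h : ‖∑ σ : Equiv.Perm (Fin n), permute σ f‖ ≤ (n ! : ℝ) * ‖f‖ := by
    refine (norm_sum_le _ _).trans ?_
    rw [Finset.sum_congr rfl fun σ _ => show ‖permute σ f‖ = ‖f‖ from (permuteIsometry σ).norm_map f]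
    simp [Fintype.card_perm]
  rw [inv_mul_le_iff₀ (by positivity)]
  exact h

variable {H : Type*} [NormedAddCommGroup H] [InnerProductSpace ℝ H]

/-- The elementary tensor as a multilinear map. -/
noncomputable def pureTensorM (e : HilbertBasis ι ℝ H) (n : ℕ) :
    MultilinearMap ℝ (fun _ : Fin n => H) (TensorPower ι n) where
  toFun := pureTensor e
  map_update_add' {_} x k a b := by
    ext i
    have := ((MultilinearMap.mkPiAlgebra ℝ (Fin n) ℝ).compLinearMap
      fun k => (innerₗ H (e (i k)) : H →ₗ[ℝ] ℝ)).map_update_add x k a b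
    exact this
  map_update_smul' {_} x k c a := by
    ext i
    have := ((MultilinearMap.mkPiAlgebra ℝ (Fin n) ℝ).compLinearMap
      fun k => (innerₗ H (e (i k)) : H →ₗ[ℝ] ℝ)).map_update_smul x k c a
    exact this

@[simp] theorem pureTensorM_apply (e : HilbertBasis ι ℝ H) (x : Fin n → H) :
    pureTensorM e n x = pureTensor e x := rfl

theorem permute_pureTensor (e : HilbertBasis ι ℝ H) (σ : Equiv.Perm (Fin n)) (x : Fin n → H) :
    permute σ (pureTensor e x) = pureTensor e (fun k => x (σ.symm k)) := by
  ext i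
  simp only [permute_apply, pureTensor_apply]
  exact Fintype.prod_equiv σ _ _ fun k => by simp

theorem isSymmetric_pureTensor_const (e : HilbertBasis ι ℝ H) (h : H) :
    IsSymmetric (pureTensor e fun _ : Fin n => h) := fun σ => permute_pureTensor e σ _

theorem symmetrize_pureTensor_perm (e : HilbertBasis ι ℝ H) (σ : Equiv.Perm (Fin n))
    (x : Fin n → H) : symmetrize (pureTensor e fun k => x (σ k)) = symmetrize (pureTensor e x) := by
  have := permute_pureTensor e σ.symm x
  rw [Equiv.symm_symm] at this
  rw [← this, symmetrize_permute]

theorem pureTensor_smul_const (e : HilbertBasis ι ℝ H) (c : ℝ) (h : H) :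
    pureTensor e (fun _ : Fin n => c • h) = c ^ n • pureTensor e (fun _ => h) := by
  have := (pureTensorM e n).map_smul_univ (fun _ => c) (fun _ => h)
  simpa using this

theorem pureTensor_zero_const (e : HilbertBasis ι ℝ H) (hn : n ≠ 0) :
    pureTensor e (fun _ : Fin n => (0 : H)) = 0 := by
  have := pureTensor_smul_const (n := n) e 0 0
  simpa [hn] using this

/-- The powers `h^{⊗n}` of unit vectors. -/
def unitPowers (e : HilbertBasis ι ℝ H) (n : ℕ) : Set (TensorPower ι n) :=
  {f | ∃ h : H, (n = 0 ∨ ‖h‖ = 1) ∧ f = pureTensor e fun _ => h}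

theorem pureTensor_const_mem_span (e : HilbertBasis ι ℝ H) (h : H) :
    pureTensor e (fun _ : Fin n => h) ∈ Submodule.span ℝ (unitPowers e n) := by
  rcases eq_or_ne n 0 with hn | hn
  · exact Submodule.subset_span ⟨h, Or.inl hn, rfl⟩
  rcases eq_or_ne h 0 with rfl | hh
  · rw [pureTensor_zero_const e hn]
    exact Submodule.zero_mem _
  · have h1 : h = ‖h‖ • (‖h‖⁻¹ • h) := by
      rw [smul_smul, mul_inv_cancel₀ (norm_ne_zero_iff.2 hh), one_smul]
    rw [h1, pureTensor_smul_const]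
    exact Submodule.smul_mem _ _ (Submodule.subset_span ⟨_, Or.inr (norm_smul_inv_norm hh), rfl⟩)

/-- Modulo the closed span of unit powers, the symmetrized elementary tensor is a symmetric
multilinear map that vanishes on the diagonal, hence is zero by polarization. Density of elementary
tensors and continuity of the symmetrization give the general case. -/
theorem symmetrize_mem_closure (e : HilbertBasis ι ℝ H) (f : TensorPower ι n) :
    symmetrize f ∈ (Submodule.span ℝ (unitPowers e n)).topologicalClosure := by
  set S := (Submodule.span ℝ (unitPowers e n)).topologicalClosure with hS
  have h1 : ∀ x : Fin n → H, symmetrizeL (pureTensor e x) ∈ S := by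
    let Ψ : MultilinearMap ℝ (fun _ : Fin n => H) (TensorPower ι n ⧸ S) :=
      (S.mkQ.comp (symmetrizeL (ι := ι) (n := n)).toLinearMap).compMultilinearMap (pureTensorM e n)
    have hΨ : ∀ x, Ψ x = S.mkQ (symmetrize (pureTensor e x)) := fun x => by
      simp [Ψ, symmetrizeL_apply]
    have h0 : Ψ = 0 := by
      refine eq_zero_of_diagonal_eq_zero Ψ (fun σ x => ?_) fun x => ?_
      · rw [hΨ, hΨ, symmetrize_pureTensor_perm]
      · rw [hΨ, symmetrize_of_isSymmetric (isSymmetric_pureTensor_const e x)]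
        rw [Submodule.mkQ_apply, Submodule.Quotient.mk_eq_zero]
        exact Submodule.le_topologicalClosure _ (pureTensor_const_mem_span e x)
    intro x
    have := hΨ x
    rw [h0, zero_apply] at this
    rw [symmetrizeL_apply]
    rw [Submodule.mkQ_apply] at this
    exact (Submodule.Quotient.mk_eq_zero S).1 this.symm
  have h2 : (Submodule.span ℝ (Set.range (pureTensor e (n := n)))).topologicalClosure ≤
      S.comap (symmetrizeL (ι := ι) (n := n)).toLinearMap := by
    refine Submodule.topologicalClosure_minimal _ (Submodule.span_le.2 ?_) ?_
    · rintro _ ⟨x, rfl⟩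
      exact h1 x
    · exact (Submodule.isClosed_topologicalClosure _).preimage (symmetrizeL (ι := ι)).continuous
  rw [dense_span_pureTensor] at h2
  have := h2 (Submodule.mem_top (x := f))
  rwa [Submodule.mem_comap, ContinuousLinearMap.coe_coe, symmetrizeL_apply] at this

end Symm

/-! ## Contractions -/

section Contraction

variable {ι : Type*} {p q r : ℕ}

/-- The inner slice `s ↦ f (a, s)`. -/
def slice (hp : r ≤ p) (f : TensorPower ι p) (a : Fin (p - r) → ι) : TensorPower ι r :=
  ⟨fun s => f (joinIndex hp a s), memℓp_two_of_summable_sq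
    ((summable_sq f).comp_injective (i := fun s => joinIndex hp a s) fun s t h =>
      (Prod.ext_iff.1 (@joinIndex_injective ι p r hp (a, s) (a, t) h)).2)⟩

theorem contractionCoord_eq_inner (hp : r ≤ p) (hq : r ≤ q) (f : TensorPower ι p)
    (g : TensorPower ι q) (i : Fin ((p - r) + (q - r)) → ι) :
    contractionCoord hp hq f g i = inner ℝ (slice hq g fun k => i (Fin.natAdd (p - r) k))
      (slice hp f fun k => i (Fin.castAdd (q - r) k)) := by
  rw [lp.inner_eq_tsum]
  rfl

theorem summable_norm_slice_sq (hp : r ≤ p) (f : TensorPower ι p) :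
    Summable fun a => ‖slice hp f a‖ ^ 2 := by
  simp only [norm_sq_eq_tsum]
  exact ((summable_sq f).comp_injective (joinIndex_injective hp)).prod

theorem tsum_norm_slice_sq_le (hp : r ≤ p) (f : TensorPower ι p) :
    ∑' a, ‖slice hp f a‖ ^ 2 ≤ ‖f‖ ^ 2 := by
  have h := (summable_sq f).comp_injective (joinIndex_injective hp)
  simp only [norm_sq_eq_tsum]
  have h2 := h.tsum_prod
  refine h2.symm.le.trans ?_
  exact tsum_comp_le_tsum_of_inj (summable_sq f) (fun _ => sq_nonneg _) (joinIndex_injective hp)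

theorem contraction_apply (hp : r ≤ p) (hq : r ≤ q) (f : TensorPower ι p) (g : TensorPower ι q)
    (i : Fin ((p - r) + (q - r)) → ι) :
    contraction r f g i = contractionCoord hp hq f g i := by
  rw [contraction, dif_pos ⟨hp, hq⟩]

/-- Cauchy–Schwarz over the contracted indices bounds each coordinate by the product of the norms of
two slices; summing the squares over the free indices factorizes. -/
theorem norm_contraction_le (f : TensorPower ι p) (g : TensorPower ι q) :
    ‖contraction r f g‖ ≤ ‖f‖ * ‖g‖ := by
  by_cases h : r ≤ p ∧ r ≤ q
  swap
  · rw [contraction, dif_neg h, norm_zero]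
    positivity
  obtain ⟨hp, hq⟩ := h
  rw [← sq_le_sq₀ (norm_nonneg _) (by positivity), mul_pow, norm_sq_eq_tsum]
  have hF := summable_norm_slice_sq hp f
  have hG := summable_norm_slice_sq hq g
  have hFG := summable_mul_of_summable_norm hF.norm hG.norm
  set E : (Fin (p - r) → ι) × (Fin (q - r) → ι) ≃ (Fin ((p - r) + (q - r)) → ι) :=
    Fin.appendEquiv (α := ι) (p - r) (q - r) with hE
  have hc : Summable fun x => contraction r f g (E x) ^ 2 :=
    (summable_sq (contraction r f g)).comp_injective E.injective
  have hle : ∀ x, contraction r f g (E x) ^ 2 ≤ ‖slice hp f x.1‖ ^ 2 * ‖slice hq g x.2‖ ^ 2 := by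
    intro x
    have h1 := abs_real_inner_le_norm (slice hq g x.2) (slice hp f x.1)
    rw [contraction_apply hp hq, contractionCoord_eq_inner, ← mul_pow, mul_comm, ← sq_abs]
    refine pow_le_pow_left₀ (abs_nonneg _) ?_ 2
    simpa [hE, Fin.appendEquiv] using h1
  calc ∑' i, contraction r f g i ^ 2
      = ∑' x, contraction r f g (E x) ^ 2 := (E.tsum_eq fun i => contraction r f g i ^ 2).symm
    _ ≤ ∑' x : (Fin (p - r) → ι) × (Fin (q - r) → ι),
          ‖slice hp f x.1‖ ^ 2 * ‖slice hq g x.2‖ ^ 2 := Summable.tsum_le_tsum hle hc hFG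
    _ = (∑' a, ‖slice hp f a‖ ^ 2) * ∑' b, ‖slice hq g b‖ ^ 2 :=
        (hF.tsum_mul_tsum hG hFG).symm
    _ ≤ ‖f‖ ^ 2 * ‖g‖ ^ 2 :=
        mul_le_mul (tsum_norm_slice_sq_le hp f) (tsum_norm_slice_sq_le hq g)
          (tsum_nonneg fun _ => sq_nonneg _) (sq_nonneg _)

/-- The contraction as a bounded bilinear map. -/
noncomputable def contractionL (ι : Type*) (p q r : ℕ) :
    TensorPower ι p →L[ℝ] TensorPower ι q →L[ℝ] TensorPower ι ((p - r) + (q - r)) :=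
  LinearMap.mkContinuous₂ (LinearMap.mk₂ ℝ (contraction (ι := ι) (p := p) (q := q) r)
    (fun f₁ f₂ g => by
      by_cases h : r ≤ p ∧ r ≤ q
      swap
      · simp [contraction, dif_neg h]
      ext i
      simp only [lp.coeFn_add, Pi.add_apply, contraction_apply h.1 h.2, contractionCoord_eq_inner]
      rw [← inner_add_right]
      rfl)
    (fun c f g => by
      by_cases h : r ≤ p ∧ r ≤ q
      swap
      · simp [contraction, dif_neg h]
      ext i
      simp only [lp.coeFn_smul, Pi.smul_apply, contraction_apply h.1 h.2,
        contractionCoord_eq_inner, smul_eq_mul]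
      rw [← real_inner_smul_right]
      rfl)
    (fun f g₁ g₂ => by
      by_cases h : r ≤ p ∧ r ≤ q
      swap
      · simp [contraction, dif_neg h]
      ext i
      simp only [lp.coeFn_add, Pi.add_apply, contraction_apply h.1 h.2, contractionCoord_eq_inner]
      rw [← inner_add_left]
      rfl)
    (fun c f g => by
      by_cases h : r ≤ p ∧ r ≤ q
      swap
      · simp [contraction, dif_neg h]
      ext i
      simp only [lp.coeFn_smul, Pi.smul_apply, contraction_apply h.1 h.2,
        contractionCoord_eq_inner, smul_eq_mul]
      rw [← real_inner_smul_left]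
      rfl)) 1 fun f g => by
    rw [one_mul]
    exact norm_contraction_le f g

@[simp] theorem contractionL_apply (f : TensorPower ι p) (g : TensorPower ι q) :
    contractionL ι p q r f g = contraction r f g := rfl

theorem prod_joinIndex {M : Type*} [CommMonoid M] (hp : r ≤ p) (a : Fin (p - r) → ι)
    (s : Fin r → ι) (u : ι → M) :
    ∏ k, u (joinIndex hp a s k) = (∏ k, u (a k)) * ∏ k, u (s k) := by
  rw [← Fintype.prod_equiv (finCongr (Nat.sub_add_cancel hp)) (fun k => u (Fin.append a s k))
    (fun k => u (joinIndex hp a s k)) fun k => by simp [joinIndex], Fin.prod_univ_add]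
  simp

variable {H : Type*} [NormedAddCommGroup H] [InnerProductSpace ℝ H]

/-- The sum over the contracted indices is Parseval's identity for h^{⊗r} and k^{⊗r}. -/
theorem contraction_pureTensor_const (e : HilbertBasis ι ℝ H) (hp : r ≤ p) (hq : r ≤ q) (h k : H) :
    contraction r (pureTensor e fun _ : Fin p => h) (pureTensor e fun _ : Fin q => k) =
      inner ℝ h k ^ r •
        pureTensor e (Fin.append (fun _ : Fin (p - r) => h) (fun _ : Fin (q - r) => k)) := by
  ext i
  rw [contraction_apply hp hq, contractionCoord]
  simp only [pureTensor_apply, lp.coeFn_smul, Pi.smul_apply, smul_eq_mul]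
  have h1 : ∀ s : Fin r → ι,
      (∏ m, inner ℝ (e (joinIndex hp (fun k => i (Fin.castAdd (q - r) k)) s m)) h) *
        ∏ m, inner ℝ (e (joinIndex hq (fun k => i (Fin.natAdd (p - r) k)) s m)) k =
      ((∏ m, inner ℝ (e (i (Fin.castAdd (q - r) m))) h) *
        ∏ m, inner ℝ (e (i (Fin.natAdd (p - r) m))) k) *
        ((∏ m, inner ℝ (e (s m)) h) * ∏ m, inner ℝ (e (s m)) k) := by
    intro s
    rw [prod_joinIndex hp _ s fun j => inner ℝ (e j) h,
      prod_joinIndex hq _ s fun j => inner ℝ (e j) k]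
    ring
  simp only [h1]
  rw [tsum_mul_left, (hasSum_pureTensor e (fun _ : Fin r => h) fun _ => k).tsum_eq,
    Fin.prod_univ_add]
  simp [mul_comm]

end Contraction

/-! ## Gaussian integration by parts -/

theorem hasDerivAt_gaussianPDFReal_zero (v : NNReal) (x : ℝ) :
    HasDerivAt (gaussianPDFReal 0 v) (-(x / v) * gaussianPDFReal 0 v x) x := by
  rw [gaussianPDFReal_def]
  simp only [sub_zero]
  have h0 : HasDerivAt (fun x : ℝ => -x ^ 2 / (2 * (v : ℝ))) (-(2 * x) / (2 * (v : ℝ))) x := by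
    simpa using ((hasDerivAt_pow 2 x).neg.div_const (2 * (v : ℝ)))
  have h1 : HasDerivAt (fun x : ℝ => -x ^ 2 / (2 * (v : ℝ))) (-(x / v)) x := by
    refine h0.congr_deriv ?_
    rw [neg_div, mul_div_mul_left _ _ (two_ne_zero)]
  refine (h1.exp.const_mul (√(2 * Real.pi * v))⁻¹).congr_deriv ?_
  ring

theorem integrable_gaussianReal_iff {v : NNReal} (hv : v ≠ 0) (f : ℝ → ℝ) :
    Integrable f (gaussianReal 0 v) ↔ Integrable fun x => gaussianPDFReal 0 v x * f x := by
  rw [gaussianReal_of_var_ne_zero _ hv, integrable_withDensity_iff_integrable_smul'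
    (measurable_gaussianPDF 0 v) (Filter.Eventually.of_forall fun x => gaussianPDF_lt_top)]
  simp [toReal_gaussianPDF]

/-- Integration by parts on the line against the density φ, using φ' = -(x/v)φ. Integrability of fφ
takes the place of a condition at infinity. -/
theorem integral_id_mul_gaussianReal {v : NNReal} (hv : v ≠ 0) {f f' : ℝ → ℝ}
    (hf : ∀ x, HasDerivAt f (f' x) x) (h1 : Integrable f (gaussianReal 0 v))
    (h2 : Integrable (fun x => x * f x) (gaussianReal 0 v))
    (h3 : Integrable f' (gaussianReal 0 v)) :
    ∫ x, x * f x ∂gaussianReal 0 v = v * ∫ x, f' x ∂gaussianReal 0 v := by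
  rw [integrable_gaussianReal_iff hv] at h1 h2 h3
  rw [integral_gaussianReal_eq_integral_smul hv, integral_gaussianReal_eq_integral_smul hv]
  have hv' : (v : ℝ) ≠ 0 := by exact_mod_cast hv
  have key := integral_mul_deriv_eq_deriv_mul_of_integrable (u := f) (v := gaussianPDFReal 0 v)
    (u' := f') (v' := fun x => -(x / v) * gaussianPDFReal 0 v x) (fun x _ => hf x)
    (fun x _ => hasDerivAt_gaussianPDFReal_zero v x)
    ((h2.const_mul (-(v : ℝ)⁻¹)).congr (Filter.Eventually.of_forall fun x => by
      simp only [Pi.mul_apply]; ring))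
    (h3.congr (Filter.Eventually.of_forall fun x => by simp only [Pi.mul_apply]; ring))
    (h1.congr (Filter.Eventually.of_forall fun x => by simp only [Pi.mul_apply]; ring))
  have e1 : ∫ x, f x * (-(x / v) * gaussianPDFReal 0 v x) =
      -(v : ℝ)⁻¹ * ∫ x, gaussianPDFReal 0 v x • (x * f x) := by
    rw [← integral_const_mul]
    exact integral_congr_ae (Filter.Eventually.of_forall fun x => by
      simp only [smul_eq_mul]; ring)
  have e2 : ∫ x, f' x * gaussianPDFReal 0 v x = ∫ x, gaussianPDFReal 0 v x • f' x :=
    integral_congr_ae (Filter.Eventually.of_forall fun x => by simp only [smul_eq_mul]; ring)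
  rw [e1, e2] at key
  field_simp at key
  linarith

section Isonormal

variable {H Ω : Type*} [NormedAddCommGroup H] [InnerProductSpace ℝ H] [MeasurableSpace Ω]
  {P : Measure Ω} {X : H → Ω → ℝ}

namespace IsIsonormal

theorem isProbabilityMeasure (hX : IsIsonormal X P) : IsProbabilityMeasure P :=
  hX.isGaussianProcess.isProbabilityMeasure

theorem aemeasurable (hX : IsIsonormal X P) (h : H) : AEMeasurable (X h) P :=
  hX.isGaussianProcess.aemeasurable h

theorem memLp (hX : IsIsonormal X P) (h : H) {p : ENNReal} (hp : p ≠ ⊤) : MemLp (X h) p P :=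
  (hX.isGaussianProcess.hasGaussianLaw_eval h).memLp hp

theorem integrable_mul (hX : IsIsonormal X P) (g h : H) :
    Integrable (fun ω => X g ω * X h ω) P :=
  (hX.memLp g (p := 2) (by simp)).integrable_mul (hX.memLp h (p := 2) (by simp))

theorem aemeasurable_pi (hX : IsIsonormal X P) {κ : Type*} [Countable κ] (w : κ → H) :
    AEMeasurable (fun ω i => X (w i) ω) P :=
  aemeasurable_pi_iff.2 fun i => hX.aemeasurable (w i)

/-- An isonormal process is linear, almost surely. -/
theorem ae_eq_sum (hX : IsIsonormal X P) {κ : Type*} [Fintype κ] (a : κ → ℝ) (v : κ → H) :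
    X (∑ i, a i • v i) =ᵐ[P] fun ω => ∑ i, a i * X (v i) ω := by
  have hI := fun i => (hX.memLp (v i) (p := 2) (by simp)).const_mul (a i)
  have hS : MemLp (fun ω => ∑ i, a i * X (v i) ω) 2 P := memLp_finsetSum _ fun i _ => hI i
  have hu := hX.memLp (∑ i, a i • v i) (p := 2) (by simp)
  have hd := hu.sub hS
  -- The second moment of the difference expands through the covariance into ‖u‖² - 2‖u‖² + ‖u‖²
  -- with u the linear combination.
  have h1 : ∫ ω, (X (∑ i, a i • v i) ω - ∑ i, a i * X (v i) ω) ^ 2 ∂P = 0 := by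
    have e : ∀ ω, (X (∑ i, a i • v i) ω - ∑ i, a i * X (v i) ω) ^ 2 =
        X (∑ i, a i • v i) ω * X (∑ i, a i • v i) ω -
          2 * ∑ i, a i * (X (v i) ω * X (∑ i, a i • v i) ω) +
          ∑ i, ∑ j, a i * a j * (X (v i) ω * X (v j) ω) := by
      intro ω
      have e1 : ∑ i, a i * (X (v i) ω * X (∑ i, a i • v i) ω) =
          (∑ i, a i * X (v i) ω) * X (∑ i, a i • v i) ω := by
        rw [Finset.sum_mul]
        exact Finset.sum_congr rfl fun i _ => by ring
      have e2 : ∑ i, ∑ j, a i * a j * (X (v i) ω * X (v j) ω) =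
          (∑ i, a i * X (v i) ω) * ∑ j, a j * X (v j) ω := by
        rw [Finset.sum_mul_sum]
        exact Finset.sum_congr rfl fun i _ => Finset.sum_congr rfl fun j _ => by ring
      rw [e1, e2]
      ring
    simp only [e]
    have i1 := hX.integrable_mul (∑ i, a i • v i) (∑ i, a i • v i)
    have i2 : ∀ i, Integrable (fun ω => a i * (X (v i) ω * X (∑ i, a i • v i) ω)) P :=
      fun i => (hX.integrable_mul _ _).const_mul _
    have i3 : ∀ i j, Integrable (fun ω => a i * a j * (X (v i) ω * X (v j) ω)) P :=
      fun i j => (hX.integrable_mul _ _).const_mul _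
    have i4 := (integrable_finsetSum Finset.univ fun i _ => i2 i).const_mul 2
    have i5 : Integrable (fun ω => X (∑ i, a i • v i) ω * X (∑ i, a i • v i) ω -
        2 * ∑ i, a i * (X (v i) ω * X (∑ i, a i • v i) ω)) P := i1.sub i4
    rw [integral_add i5
      (integrable_finsetSum _ fun i _ => integrable_finsetSum _ fun j _ => i3 i j),
      integral_sub i1 i4,
      integral_const_mul, integral_finsetSum _ fun i _ => i2 i,
      integral_finsetSum _ fun i _ => integrable_finsetSum _ fun j _ => i3 i j]
    simp only [integral_finsetSum _ fun j _ => i3 _ j, integral_const_mul, hX.covariance]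
    have e3 : ∀ i, ∑ j, a i * a j * inner ℝ (v i) (v j) =
        a i * inner ℝ (v i) (∑ j, a j • v j) := by
      intro i
      rw [inner_sum, Finset.mul_sum]
      exact Finset.sum_congr rfl fun j _ => by rw [real_inner_smul_right]; ring
    simp only [e3]
    rw [sum_inner]
    simp only [real_inner_smul_left]
    ring
  have h2 := (integral_eq_zero_iff_of_nonneg (fun ω => sq_nonneg _) hd.integrable_sq).1 h1
  filter_upwards [h2] with ω hω
  simpa [sub_eq_zero] using hω

theorem ae_eq_zero (hX : IsIsonormal X P) : X 0 =ᵐ[P] 0 := by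
  have := hX.ae_eq_sum (κ := Empty) (fun _ => 0) (fun _ => 0)
  simpa using! this

theorem hasLaw (hX : IsIsonormal X P) (h : H) :
    P.map (X h) = gaussianReal 0 (‖h‖₊ ^ 2) := by
  have := hX.isProbabilityMeasure
  rw [(hX.isGaussianProcess.hasGaussianLaw_eval h).map_eq_gaussianReal, hX.integral_eq_zero]
  congr 1
  rw [variance_of_integral_eq_zero (hX.aemeasurable h) (hX.integral_eq_zero h)]
  have : ∫ ω, X h ω ^ 2 ∂P = ‖h‖ ^ 2 := by
    simp only [sq, hX.covariance, real_inner_self_eq_norm_mul_norm]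
  rw [this]
  ext
  simp

/-- Subtracting from `X(wᵢ)` its projection on `X(h)` leaves a vector independent of `X(h)`. -/
theorem indepFun_sub (hX : IsIsonormal X P) {κ : Type*} (w : κ → H) {h : H}
    (hh : h ≠ 0) :
    IndepFun (X h) (fun ω i => X (w i) ω - inner ℝ (w i) h / ‖h‖ ^ 2 * X h ω) P := by
  classical
  have := hX.isProbabilityMeasure
  set b : κ → ℝ := fun i => inner ℝ (w i) h / ‖h‖ ^ 2 with hb
  set Y : κ → Ω → ℝ := fun i ω => X (w i) ω - b i * X h ω with hY
  -- Each member is a linear combination of at most two variables of X, so the whole family is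
  -- jointly Gaussian, and zero covariance will imply independence.
  have hG : IsGaussianProcess (Sum.elim (fun _ : Unit => X h) Y) P := by
    refine hX.isGaussianProcess.of_isGaussianProcess fun s => ?_
    rcases s with s | i
    · exact ⟨{h}, ContinuousLinearMap.proj ⟨h, by simp⟩, fun ω => rfl⟩
    · exact ⟨{w i, h}, ContinuousLinearMap.proj ⟨w i, by simp⟩ -
        b i • ContinuousLinearMap.proj ⟨h, by simp⟩, fun ω => rfl⟩
  have hYm : ∀ i, AEMeasurable (Y i) P := fun i =>
    (hX.aemeasurable (w i)).sub ((hX.aemeasurable h).const_mul (b i))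
  have h1 := hG.indepFun_of_covariance_eq_zero (fun _ => hX.aemeasurable h) hYm fun _ i => by
    have hm := hX.memLp h (p := 2) (by simp)
    have hw := hX.memLp (w i) (p := 2) (by simp)
    have hYi : MemLp (Y i) 2 P := hw.sub (hm.const_mul (b i))
    rw [covariance_eq_sub hm hYi, hX.integral_eq_zero, zero_mul, sub_zero]
    have e : X h * Y i = fun ω => X h ω * X (w i) ω - b i * (X h ω * X h ω) := by
      funext ω
      simp only [hY, Pi.mul_apply]
      ring
    rw [e, integral_sub (hX.integrable_mul _ _) ((hX.integrable_mul _ _).const_mul _),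
      integral_const_mul, hX.covariance, hX.covariance, real_inner_self_eq_norm_sq, hb,
      real_inner_comm]
    have : ‖h‖ ≠ 0 := norm_ne_zero_iff.2 hh
    field_simp
    ring
  exact h1.comp (measurable_pi_apply ()) measurable_id

/-- Gaussian integration by parts. -/
theorem integral_mul_eq (hX : IsIsonormal X P) (h : H) {κ : Type*} [Fintype κ] (w : κ → H)
    {ψ : (κ → ℝ) → ℝ} (hψ : ContDiff ℝ 1 ψ)
    (h1 : Integrable (fun ω => ψ fun i => X (w i) ω) P)
    (h2 : Integrable (fun ω => X h ω * ψ fun i => X (w i) ω) P)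
    (h3 : Integrable (fun ω => fderiv ℝ ψ (fun i => X (w i) ω) fun i => inner ℝ (w i) h) P) :
    ∫ ω, X h ω * ψ (fun i => X (w i) ω) ∂P =
      ∫ ω, fderiv ℝ ψ (fun i => X (w i) ω) (fun i => inner ℝ (w i) h) ∂P := by
  have := hX.isProbabilityMeasure
  rcases eq_or_ne h 0 with rfl | hh
  · have e : (fun ω => X 0 ω * ψ fun i => X (w i) ω) =ᵐ[P] fun _ => 0 := by
      filter_upwards [hX.ae_eq_zero] with ω hω
      simp [hω]
    rw [integral_congr_ae e]
    have e' : (fun i => inner ℝ (w i) (0 : H)) = 0 := funext fun i => inner_zero_right _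
    simp only [e', map_zero]
  set b : κ → ℝ := fun i => inner ℝ (w i) h / ‖h‖ ^ 2 with hb
  set Y : Ω → κ → ℝ := fun ω i => X (w i) ω - b i * X h ω with hY
  set v : NNReal := ‖h‖₊ ^ 2 with hv
  have hv0 : v ≠ 0 := pow_ne_zero _ (nnnorm_ne_zero_iff.2 hh)
  have hYm : AEMeasurable Y P := aemeasurable_pi_iff.2 fun i =>
    (hX.aemeasurable (w i)).sub ((hX.aemeasurable h).const_mul (b i))
  have hXm := hX.aemeasurable h
  -- The vector of the X(wᵢ) equals Y + X(h) b with Y independent of X(h). After Fubini, Y is frozen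
  -- and the one-dimensional identity is used in the direction b.
  have hlaw : P.map (fun ω => (X h ω, Y ω)) = (gaussianReal 0 v).prod (P.map Y) := by
    rw [← hX.hasLaw h]
    exact (indepFun_iff_map_prod_eq_prod_map_map hXm hYm).1 (hX.indepFun_sub w hh)
  have hXY : AEMeasurable (fun ω => (X h ω, Y ω)) P := hXm.prodMk hYm
  have hXw : ∀ ω, (fun i => X (w i) ω) = Y ω + X h ω • b := by
    intro ω
    funext i
    simp only [hY, Pi.add_apply, Pi.smul_apply, smul_eq_mul]
    ring
  -- The variance ‖h‖² produced by the one-dimensional identity cancels the denominator of b.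
  have hvb : (fun i => inner ℝ (w i) h) = (v : ℝ) • b := by
    funext i
    have : ‖h‖ ≠ 0 := norm_ne_zero_iff.2 hh
    simp only [hb, hv, Pi.smul_apply, smul_eq_mul, NNReal.coe_pow, coe_nnnorm]
    field_simp
  have hψm : Measurable ψ := hψ.continuous.measurable
  have hadd : Measurable fun z : ℝ × (κ → ℝ) => z.2 + z.1 • b := by fun_prop
  have hψ'm : Measurable fun z => fderiv ℝ ψ z b :=
    ((hψ.continuous_fderiv (by simp)).clm_apply continuous_const).measurable
  simp only [hXw, hvb, map_smul, smul_eq_mul] at h1 h2 h3 ⊢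
  have m1 : Measurable fun z : ℝ × (κ → ℝ) => ψ (z.2 + z.1 • b) := hψm.comp hadd
  have m2 : Measurable fun z : ℝ × (κ → ℝ) => z.1 * ψ (z.2 + z.1 • b) := measurable_fst.mul m1
  have m3 : Measurable fun z : ℝ × (κ → ℝ) => (v : ℝ) * fderiv ℝ ψ (z.2 + z.1 • b) b :=
    (hψ'm.comp hadd).const_mul _
  have j1 := (integrable_map_measure m1.aestronglyMeasurable hXY).2 h1
  have j2 := (integrable_map_measure m2.aestronglyMeasurable hXY).2 h2
  have j3 := (integrable_map_measure m3.aestronglyMeasurable hXY).2 h3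
  rw [← integral_map hXY (f := fun z : ℝ × (κ → ℝ) => z.1 * ψ (z.2 + z.1 • b))
      m2.aestronglyMeasurable,
    ← integral_map hXY (f := fun z : ℝ × (κ → ℝ) => (v : ℝ) * fderiv ℝ ψ (z.2 + z.1 • b) b)
      m3.aestronglyMeasurable]
  rw [hlaw] at j1 j2 j3 ⊢
  have : IsProbabilityMeasure (P.map Y) := Measure.isProbabilityMeasure_map hYm
  rw [integral_prod_symm _ j2, integral_prod_symm _ j3]
  refine integral_congr_ae ?_
  filter_upwards [j1.prod_left_ae, j2.prod_left_ae, j3.prod_left_ae] with y k1 k2 k3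
  have k3' : Integrable (fun x => fderiv ℝ ψ (y + x • b) b) (gaussianReal 0 v) := by
    have hv1 : (v : ℝ) ≠ 0 := by exact_mod_cast hv0
    refine (k3.const_mul (v : ℝ)⁻¹).congr (Filter.Eventually.of_forall fun x => ?_)
    simp only
    field_simp
  rw [integral_const_mul]
  refine integral_id_mul_gaussianReal hv0 (fun x => ?_) k1 k2 k3'
  have hd : HasDerivAt (fun x : ℝ => y + x • b) b x := by
    simpa using ((hasDerivAt_id x).smul_const b).const_add y
  exact ((hψ.differentiable (by simp)) (y + x • b)).hasFDerivAt.comp_hasDerivAt x hd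

end IsIsonormal

end Isonormal

/-! ## Polynomials in Gaussian variables -/

theorem eval_aeval_X {κ : Type*} (p : Polynomial ℤ) (i : κ) (x : κ → ℝ) :
    MvPolynomial.eval x (Polynomial.aeval (MvPolynomial.X i : MvPolynomial κ ℝ) p) =
      Polynomial.aeval (x i) p := by
  have := Polynomial.hom_eval₂ p (algebraMap ℤ (MvPolynomial κ ℝ)) (MvPolynomial.eval x)
    (MvPolynomial.X i)
  rw [Polynomial.aeval_def, Polynomial.aeval_def, this, MvPolynomial.eval_X]
  congr 1
  exact RingHom.ext_int _ _

section Poly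

variable {κ : Type*}

theorem contDiff_eval [Fintype κ] (p : MvPolynomial κ ℝ) (n : WithTop ℕ∞) :
    ContDiff ℝ n fun x : κ → ℝ => MvPolynomial.eval x p := by
  induction p using MvPolynomial.induction_on with
  | C a => simpa using contDiff_const
  | add p q hp hq => simpa using hp.add hq
  | mul_X p i hp => simpa using hp.mul (contDiff_apply ℝ ℝ i)

theorem fderiv_eval [Fintype κ] (p : MvPolynomial κ ℝ) (x b : κ → ℝ) :
    fderiv ℝ (fun x : κ → ℝ => MvPolynomial.eval x p) x b =
      MvPolynomial.eval x (MvPolynomial.mkDerivation ℝ (fun j => MvPolynomial.C (b j)) p) := by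
  have hd : ∀ p : MvPolynomial κ ℝ,
      DifferentiableAt ℝ (fun x : κ → ℝ => MvPolynomial.eval x p) x :=
    fun p => ((contDiff_eval p 1).differentiable (by simp)) x
  induction p using MvPolynomial.induction_on with
  | C a => simp
  | add p q hp hq =>
    simp only [map_add]
    rw [fderiv_fun_add (hd p) (hd q), add_apply, hp, hq]
  | mul_X p i hp =>
    have hi : DifferentiableAt ℝ (fun x : κ → ℝ => x i) x := by fun_prop
    have hi' : fderiv ℝ (fun x : κ → ℝ => x i) x b = b i := by
      rw [show (fun x : κ → ℝ => x i) = (ContinuousLinearMap.proj i : (κ → ℝ) →L[ℝ] ℝ) from rfl,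
        ContinuousLinearMap.fderiv]
      rfl
    simp only [map_mul, MvPolynomial.eval_X]
    rw [fderiv_fun_mul (hd p) hi, Derivation.leibniz, MvPolynomial.mkDerivation_X]
    simp [hp, hi']

variable {H Ω : Type*} [NormedAddCommGroup H] [InnerProductSpace ℝ H] [MeasurableSpace Ω]
  {P : Measure Ω} {X : H → Ω → ℝ}

/-- The matrix of inner products of a family of vectors. -/
def gram (v : κ → H) (i j : κ) : ℝ := inner ℝ (v i) (v j)

theorem gram_comm (v : κ → H) (i j : κ) : gram v i j = gram v j i := real_inner_comm _ _

/-- The random variable `p(X(v₁), …, X(vₙ))`. -/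
noncomputable def polyVar (X : H → Ω → ℝ) (v : κ → H) (p : MvPolynomial κ ℝ) (ω : Ω) : ℝ :=
  MvPolynomial.eval (fun i => X (v i) ω) p

namespace IsIsonormal

theorem memLp_polyVar (hX : IsIsonormal X P) (v : κ → H) (p : MvPolynomial κ ℝ) {r : ENNReal}
    (hr : r ≠ ⊤) : MemLp (polyVar X v p) r P := by
  have := hX.isProbabilityMeasure
  induction p using MvPolynomial.induction_on generalizing r with
  | C a =>
    unfold polyVar
    simpa using memLp_const a
  | add p q hp hq =>
    have : polyVar X v (p + q) = polyVar X v p + polyVar X v q := by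
      funext ω
      simp [polyVar]
    rw [this]
    exact (hp hr).add (hq hr)
  | mul_X p i hp =>
    have e : polyVar X v (p * MvPolynomial.X i) = X (v i) * polyVar X v p := by
      funext ω
      simp [polyVar, mul_comm]
    -- Hölder with both factors in L^{2r}. The exponent doubles at each step, which is why the
    -- induction generalizes r.
    have ht : ENNReal.HolderTriple (2 * r) (2 * r) r := ⟨by
      rw [ENNReal.mul_inv (by simp) (by simp), ← add_mul, ENNReal.inv_two_add_inv_two, one_mul]⟩
    have h2r : 2 * r ≠ ⊤ := ENNReal.mul_ne_top (by simp) hr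
    rw [e]
    exact (hp h2r).mul (hX.memLp (v i) h2r)

theorem integrable_polyVar (hX : IsIsonormal X P) (v : κ → H) (p : MvPolynomial κ ℝ) :
    Integrable (polyVar X v p) P :=
  memLp_one_iff_integrable.1 (hX.memLp_polyVar v p (by simp))

/-- Evaluated at the Gaussian vector, `wickDeriv (gram v) i` is differentiation in the direction
(⟨vⱼ, vᵢ⟩)ⱼ, exactly the direction in Gaussian integration by parts. -/
theorem integral_X_mul [Fintype κ] (hX : IsIsonormal X P) (v : κ → H) (i : κ)
    (p : MvPolynomial κ ℝ) :
    ∫ ω, polyVar X v (MvPolynomial.X i * p) ω ∂P = ∫ ω, polyVar X v (wickDeriv (gram v) i p) ω ∂P := by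
  have e1 : ∀ ω, polyVar X v (MvPolynomial.X i * p) ω =
      X (v i) ω * MvPolynomial.eval (fun i => X (v i) ω) p := fun ω => by simp [polyVar]
  have e2 : ∀ ω, polyVar X v (wickDeriv (gram v) i p) ω =
      fderiv ℝ (fun x : κ → ℝ => MvPolynomial.eval x p) (fun i => X (v i) ω)
        (fun j => inner ℝ (v j) (v i)) := fun ω => by
    rw [fderiv_eval, polyVar, wickDeriv]
    simp only [gram, real_inner_comm (v i)]
  simp only [e1, e2]
  refine hX.integral_mul_eq (v i) v (ψ := fun x => MvPolynomial.eval x p) (contDiff_eval p 1)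
    (hX.integrable_polyVar v p) ?_ ?_
  · exact (hX.integrable_polyVar v (MvPolynomial.X i * p)).congr
      (Filter.Eventually.of_forall e1)
  · exact (hX.integrable_polyVar v (wickDeriv (gram v) i p)).congr
      (Filter.Eventually.of_forall e2)

theorem integral_polyVar_add (hX : IsIsonormal X P) (v : κ → H) (p q : MvPolynomial κ ℝ) :
    ∫ ω, polyVar X v (p + q) ω ∂P = ∫ ω, polyVar X v p ω ∂P + ∫ ω, polyVar X v q ω ∂P := by
  rw [← integral_add (hX.integrable_polyVar v p) (hX.integrable_polyVar v q)]
  simp [polyVar]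

theorem integral_polyVar_smul (v : κ → H) (a : ℝ) (p : MvPolynomial κ ℝ) :
    ∫ ω, polyVar X v (a • p) ω ∂P = a * ∫ ω, polyVar X v p ω ∂P := by
  rw [← integral_const_mul]
  simp [polyVar, MvPolynomial.smul_eval]

/-- The creation operator is the adjoint of the derivation. -/
theorem integral_creation_mul [Fintype κ] (hX : IsIsonormal X P) (v : κ → H) (i : κ)
    (p q : MvPolynomial κ ℝ) :
    ∫ ω, polyVar X v (creation (gram v) i p * q) ω ∂P =
      ∫ ω, polyVar X v (p * wickDeriv (gram v) i q) ω ∂P := by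
  have h1 := hX.integral_X_mul v i (p * q)
  have e1 : MvPolynomial.X i * (p * q) =
      creation (gram v) i p * q + wickDeriv (gram v) i p * q := by
    rw [creation_apply]
    ring
  rw [e1, Derivation.leibniz, hX.integral_polyVar_add, hX.integral_polyVar_add, smul_eq_mul,
    smul_eq_mul, mul_comm q] at h1
  linarith

/-- Moving one creation operator across the integral turns it into a derivation, which lowers the
other power by one and yields the factor n⟨vᵢ, vⱼ⟩. If the powers differ, a derivation eventually
meets the constant 1. -/
theorem integral_creation_pow_mul [Fintype κ] (hX : IsIsonormal X P) (v : κ → H) (i j : κ)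
    (m n : ℕ) :
    ∫ ω, polyVar X v ((creation (gram v) i ^ m) 1 * (creation (gram v) j ^ n) 1) ω ∂P =
      if m = n then (n ! : ℝ) * inner ℝ (v i) (v j) ^ n else 0 := by
  have := hX.isProbabilityMeasure
  induction m generalizing n with
  | zero =>
    rcases n with _ | n
    · simp [polyVar]
    · rw [pow_succ' _ n, Module.End.mul_apply, mul_comm, hX.integral_creation_mul]
      simp [polyVar]
  | succ m ih =>
    rw [pow_succ' _ m, Module.End.mul_apply, hX.integral_creation_mul, wickDeriv_creation_pow,
      mul_smul_comm, integral_polyVar_smul, ih]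
    rcases n with _ | n
    · simp
    · simp only [Nat.add_sub_cancel, add_left_inj, Nat.factorial_succ, gram, pow_succ]
      split_ifs
      · push_cast
        ring
      · simp

end IsIsonormal

theorem polyVar_creation_pow [Fintype κ] (v : κ → H) (i : κ) {n : ℕ}
    (h : n = 0 ∨ ‖v i‖ = 1) (ω : Ω) :
    polyVar X v ((creation (gram v) i ^ n) 1) ω =
      Polynomial.aeval (X (v i) ω) (Polynomial.hermite n) := by
  classical
  rcases h with rfl | h
  · simp [polyVar]
  have h1 : ∑ k, ∑ l, (Pi.single i 1 : κ → ℝ) k * (Pi.single i 1 : κ → ℝ) l * gram v k l = 1 := by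
    rw [Finset.sum_eq_single i, Finset.sum_eq_single i]
    · simp [gram, h]
    all_goals simp +contextual [Pi.single_apply]
  rw [← creationLin_single, creationLin_pow_one h1, polyVar]
  have h2 : (∑ k, (Pi.single i 1 : κ → ℝ) k • MvPolynomial.X k : MvPolynomial κ ℝ) =
      MvPolynomial.X i := by
    rw [Finset.sum_eq_single i] <;> simp +contextual
  rw [h2]
  exact eval_aeval_X _ i _

/-- The variable `H_n(X(h))` for the monic Hermite polynomial `H_n`. -/
noncomputable def hermiteVar (X : H → Ω → ℝ) (n : ℕ) (h : H) (ω : Ω) : ℝ :=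
  Polynomial.aeval (X h ω) (Polynomial.hermite n)

namespace IsIsonormal

theorem memLp_hermiteVar (hX : IsIsonormal X P) (n : ℕ) (h : H) {r : ENNReal}
    (hr : r ≠ ⊤) : MemLp (hermiteVar X n h) r P := by
  have e : hermiteVar X n h = polyVar X (fun _ : Unit => h)
      (Polynomial.aeval (MvPolynomial.X ()) (Polynomial.hermite n)) := by
    funext ω
    rw [hermiteVar, polyVar, eval_aeval_X]
  rw [e]
  exact hX.memLp_polyVar _ _ hr

theorem integral_hermiteVar_mul (hX : IsIsonormal X P) {m n : ℕ} {g h : H}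
    (hg : m = 0 ∨ ‖g‖ = 1) (hh : n = 0 ∨ ‖h‖ = 1) :
    ∫ ω, hermiteVar X m g ω * hermiteVar X n h ω ∂P =
      if m = n then (n ! : ℝ) * inner ℝ g h ^ n else 0 := by
  refine Eq.trans ?_ (hX.integral_creation_pow_mul ![g, h] 0 1 m n)
  refine integral_congr_ae (Filter.Eventually.of_forall fun ω => ?_)
  have h0 := polyVar_creation_pow (X := X) ![g, h] 0 (n := m) (by simpa using hg) ω
  have h1 := polyVar_creation_pow (X := X) ![g, h] 1 (n := n) (by simpa using hh) ω
  simp only [polyVar] at h0 h1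
  simp only [polyVar, map_mul, h0, h1]
  rfl

end IsIsonormal

end Poly

/-! ## The Malliavin derivative -/

theorem tendsto_toLp_of_dominated {Ω E : Type*} [MeasurableSpace Ω] [NormedAddCommGroup E]
    {P : Measure Ω} {f : ℕ → Ω → E} {f₀ : Ω → E} {b : Ω → ℝ} (hf : ∀ n, MemLp (f n) 2 P)
    (hf₀ : MemLp f₀ 2 P) (hb : MemLp b 2 P) (hle : ∀ n, ∀ᵐ ω ∂P, ‖f n ω‖ ≤ b ω)
    (hlim : ∀ᵐ ω ∂P, Filter.Tendsto (fun n => f n ω) Filter.atTop (nhds (f₀ ω))) :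
    Filter.Tendsto (fun n => (hf n).toLp) Filter.atTop (nhds hf₀.toLp) := by
  have hnorm : ∀ n, ‖(hf n).toLp - hf₀.toLp‖ ^ 2 = ∫ ω, ‖f n ω - f₀ ω‖ ^ 2 ∂P := by
    intro n
    rw [← MemLp.toLp_sub, Lp.norm_toLp, eLpNorm_eq_eLpNorm' (by simp) (by simp)]
    have h := ((hf n).sub hf₀).eLpNorm_eq_integral_rpow_norm (by simp) (by simp)
    rw [← eLpNorm_eq_eLpNorm' (by simp) (by simp), h, ENNReal.toReal_ofReal (by positivity)]
    rw [← Real.rpow_natCast, ← Real.rpow_mul (integral_nonneg fun ω => by positivity)]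
    simp
  have h0 : Filter.Tendsto (fun n => ∫ ω, ‖f n ω - f₀ ω‖ ^ 2 ∂P) Filter.atTop (nhds 0) := by
    have hl0 : ∀ᵐ ω ∂P, ‖f₀ ω‖ ≤ b ω := by
      filter_upwards [ae_all_iff.2 hle, hlim] with ω h1 h2
      exact le_of_tendsto h2.norm (Filter.Eventually.of_forall h1)
    have := tendsto_integral_of_dominated_convergence (μ := P)
      (F := fun n ω => ‖f n ω - f₀ ω‖ ^ 2) (f := fun _ => (0 : ℝ)) (fun ω => (2 * b ω) ^ 2)
      (fun n => (((hf n).sub hf₀).aestronglyMeasurable.norm.pow 2))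
      (hb.const_mul 2).integrable_sq (fun n => ?_) ?_
    · simpa using this
    · filter_upwards [hle n, hl0] with ω h1 h2
      rw [Real.norm_of_nonneg (by positivity)]
      refine pow_le_pow_left₀ (norm_nonneg _) ((norm_sub_le _ _).trans ?_) 2
      linarith
    · filter_upwards [hlim] with ω h
      have := ((h.sub_const (f₀ ω)).norm).pow 2
      simpa using this
  rw [tendsto_iff_norm_sub_tendsto_zero]
  have h1 := h0.congr fun n => (hnorm n).symm
  have h2 := h1.sqrt
  simpa using h2

section Malliavin

variable {H Ω : Type*} [NormedAddCommGroup H] [InnerProductSpace ℝ H] [MeasurableSpace Ω]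
  {P : Measure Ω} {X : H → Ω → ℝ}

theorem sum_fderiv_single {n : ℕ} {E : Type*} [NormedAddCommGroup E] [NormedSpace ℝ E]
    (L : (Fin n → ℝ) →L[ℝ] E) (b : Fin n → ℝ) : ∑ i, b i • L (Pi.single i 1) = L b := by
  conv_rhs => rw [pi_eq_sum_univ' b, map_sum]
  refine Finset.sum_congr rfl fun i _ => ?_
  rw [← map_smul]

namespace IsIsonormal

theorem memLp_comp_of_bound (hX : IsIsonormal X P) {E : Type*} [NormedAddCommGroup E] {κ : Type*}
    [Fintype κ] (w : κ → H) {g : (κ → ℝ) → E} (hg : Continuous g) {C : ℝ} (hC : ∀ x, ‖g x‖ ≤ C)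
    (p : ENNReal) : MemLp (fun ω => g fun i => X (w i) ω) p P := by
  have := hX.isProbabilityMeasure
  exact MemLp.of_bound (hg.comp_aestronglyMeasurable (hX.aemeasurable_pi w).aestronglyMeasurable) C
    (Filter.Eventually.of_forall fun ω => hC _)

/-- Integration by parts for the product of two smooth functions with compact support. -/
theorem integral_fderiv_mul (hX : IsIsonormal X P) (h : H) {n m : ℕ} (v : Fin n → H)
    (u : Fin m → H) {g : (Fin n → ℝ) → ℝ} {k : (Fin m → ℝ) → ℝ} (hg : ContDiff ℝ (⊤ : ℕ∞) g)
    (hgc : HasCompactSupport g) (hk : ContDiff ℝ (⊤ : ℕ∞) k) (hkc : HasCompactSupport k) :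
    ∫ ω, fderiv ℝ g (fun i => X (v i) ω) (fun i => inner ℝ (v i) h) * k (fun i => X (u i) ω) ∂P =
      ∫ ω, g (fun i => X (v i) ω) * (X h ω * k (fun i => X (u i) ω) -
        fderiv ℝ k (fun i => X (u i) ω) (fun i => inner ℝ (u i) h)) ∂P := by
  have := hX.isProbabilityMeasure
  let L₁ : (Fin n ⊕ Fin m → ℝ) →L[ℝ] (Fin n → ℝ) :=
    ContinuousLinearMap.pi fun i => ContinuousLinearMap.proj (Sum.inl i)
  let L₂ : (Fin n ⊕ Fin m → ℝ) →L[ℝ] (Fin m → ℝ) :=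
    ContinuousLinearMap.pi fun i => ContinuousLinearMap.proj (Sum.inr i)
  set w : Fin n ⊕ Fin m → H := Sum.elim v u with hw
  -- The product of the two functionals is one function of the concatenated family, so integration
  -- by parts for a single function and the product rule suffice.
  set ψ : (Fin n ⊕ Fin m → ℝ) → ℝ := fun z => g (L₁ z) * k (L₂ z) with hψ
  have hg1 : ContDiff ℝ 1 g := hg.of_le (by exact_mod_cast le_top)
  have hk1 : ContDiff ℝ 1 k := hk.of_le (by exact_mod_cast le_top)
  have hgd : Continuous (fderiv ℝ g) := hg1.continuous_fderiv (by simp)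
  have hkd : Continuous (fderiv ℝ k) := hk1.continuous_fderiv (by simp)
  obtain ⟨C₁, hC₁⟩ := hgc.exists_bound_of_continuous hg.continuous
  obtain ⟨C₂, hC₂⟩ := hkc.exists_bound_of_continuous hk.continuous
  obtain ⟨D₁, hD₁⟩ := (hgc.fderiv (𝕜 := ℝ)).exists_bound_of_continuous hgd
  obtain ⟨D₂, hD₂⟩ := (hkc.fderiv (𝕜 := ℝ)).exists_bound_of_continuous hkd
  have hψ1 : ContDiff ℝ 1 ψ := (hg1.comp L₁.contDiff).mul (hk1.comp L₂.contDiff)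
  have hfd : ∀ z b, fderiv ℝ ψ z b = g (L₁ z) * fderiv ℝ k (L₂ z) (L₂ b) +
      fderiv ℝ g (L₁ z) (L₁ b) * k (L₂ z) := by
    intro z b
    have d1 : HasFDerivAt (fun z => g (L₁ z)) ((fderiv ℝ g (L₁ z)).comp L₁) z :=
      ((hg1.differentiable (by simp)) (L₁ z)).hasFDerivAt.comp z L₁.hasFDerivAt
    have d2 : HasFDerivAt (fun z => k (L₂ z)) ((fderiv ℝ k (L₂ z)).comp L₂) z :=
      ((hk1.differentiable (by simp)) (L₂ z)).hasFDerivAt.comp z L₂.hasFDerivAt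
    rw [hψ, fderiv_fun_mul d1.differentiableAt d2.differentiableAt, d1.fderiv, d2.fderiv]
    simp [mul_comm]
  have mg := hX.memLp_comp_of_bound v hg.continuous hC₁ 2
  have mk := hX.memLp_comp_of_bound u hk.continuous hC₂ 2
  have mg' : MemLp (fun ω => fderiv ℝ g (fun i => X (v i) ω) fun i => inner ℝ (v i) h) 2 P :=
    hX.memLp_comp_of_bound v (g := fun x => fderiv ℝ g x fun i => inner ℝ (v i) h)
      (hgd.clm_apply continuous_const)
      (fun x => ((fderiv ℝ g x).le_opNorm _).trans
        (mul_le_mul_of_nonneg_right (hD₁ x) (norm_nonneg _))) 2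
  have mk' : MemLp (fun ω => fderiv ℝ k (fun i => X (u i) ω) fun i => inner ℝ (u i) h) 2 P :=
    hX.memLp_comp_of_bound u (g := fun x => fderiv ℝ k x fun i => inner ℝ (u i) h)
      (hkd.clm_apply continuous_const)
      (fun x => ((fderiv ℝ k x).le_opNorm _).trans
        (mul_le_mul_of_nonneg_right (hD₂ x) (norm_nonneg _))) 2
  have hbd : ∀ z, ‖ψ z‖ ≤ C₁ * C₂ := fun z => by
    rw [hψ, norm_mul]
    exact mul_le_mul (hC₁ _) (hC₂ _) (norm_nonneg _) ((norm_nonneg _).trans (hC₁ (L₁ z)))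
  have mψ : ∀ p, MemLp (fun ω => ψ fun i => X (w i) ω) p P :=
    hX.memLp_comp_of_bound w hψ1.continuous hbd
  have i2 : Integrable (fun ω => X h ω * ψ fun i => X (w i) ω) P :=
    (hX.memLp h (p := 2) (by simp)).integrable_mul (mψ 2)
  have i4 : Integrable (fun ω => g (fun i => X (v i) ω) *
      fderiv ℝ k (fun i => X (u i) ω) (fun i => inner ℝ (u i) h)) P := mg.integrable_mul mk'
  have i5 : Integrable (fun ω => fderiv ℝ g (fun i => X (v i) ω) (fun i => inner ℝ (v i) h) *
      k (fun i => X (u i) ω)) P := mg'.integrable_mul mk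
  have e3 : ∀ ω, fderiv ℝ ψ (fun i => X (w i) ω) (fun i => inner ℝ (w i) h) =
      g (fun i => X (v i) ω) * fderiv ℝ k (fun i => X (u i) ω) (fun i => inner ℝ (u i) h) +
      fderiv ℝ g (fun i => X (v i) ω) (fun i => inner ℝ (v i) h) * k (fun i => X (u i) ω) :=
    fun ω => hfd _ _
  have key := hX.integral_mul_eq h w hψ1 (memLp_one_iff_integrable.1 (mψ 1)) i2
    ((i4.add i5).congr (Filter.Eventually.of_forall fun ω => (e3 ω).symm))
  simp only [e3] at key
  rw [integral_add i4 i5] at key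
  have e6 : ∀ ω, g (fun i => X (v i) ω) * (X h ω * k (fun i => X (u i) ω) -
        fderiv ℝ k (fun i => X (u i) ω) (fun i => inner ℝ (u i) h)) =
      X h ω * ψ (fun i => X (w i) ω) - g (fun i => X (v i) ω) *
        fderiv ℝ k (fun i => X (u i) ω) (fun i => inner ℝ (u i) h) := by
    intro ω
    change _ = X h ω * (g (fun i => X (v i) ω) * k (fun i => X (u i) ω)) - _
    ring
  simp only [e6]
  rw [integral_sub i2 i4, key]
  ring

end IsIsonormal

/-- The variables `k(X(u₁), …, X(uₘ)) h` with `k` smooth with compact support. -/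
def cylindricalVectors (X : H → Ω → ℝ) (P : Measure Ω) : Set (Lp H 2 P) :=
  {W | ∃ (m : ℕ) (u : Fin m → H) (k : (Fin m → ℝ) → ℝ) (h : H),
    ContDiff ℝ (⊤ : ℕ∞) k ∧ HasCompactSupport k ∧
      W =ᵐ[P] fun ω => k (fun i => X (u i) ω) • h}

namespace IsIsonormal

/-- All derivatives lie in the closed span of the test vectors. Closability can then be tested
inside that span, without showing that it is all of L²(P; H). -/
theorem snd_mem_span_of_mem_cylindricalPairs (hX : IsIsonormal X P) {p : Lp ℝ 2 P × Lp H 2 P}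
    (hp : p ∈ cylindricalPairs X P) :
    p.2 ∈ Submodule.span ℝ (cylindricalVectors X P) := by
  obtain ⟨n, v, g, -, hg, hgc, -, h2⟩ := hp
  have hg' : ∀ i, ContDiff ℝ (⊤ : ℕ∞) fun x => fderiv ℝ g x (Pi.single i 1) := fun i =>
    (hg.fderiv_right (by simp)).clm_apply contDiff_const
  have hgc' : ∀ i, HasCompactSupport fun x => fderiv ℝ g x (Pi.single i 1) := fun i =>
    hgc.fderiv_apply (𝕜 := ℝ) _
  have hm : ∀ i, MemLp (fun ω => fderiv ℝ g (fun j => X (v j) ω) (Pi.single i 1) • v i) 2 P := by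
    intro i
    obtain ⟨C, hC⟩ := (hgc' i).exists_bound_of_continuous (hg' i).continuous
    exact hX.memLp_comp_of_bound v (g := fun x => fderiv ℝ g x (Pi.single i 1) • v i)
      ((hg' i).continuous.smul continuous_const) (C := C * ‖v i‖) (fun x => by
        rw [norm_smul]
        exact mul_le_mul_of_nonneg_right (hC x) (norm_nonneg _)) 2
  have e : p.2 = ∑ i, (hm i).toLp := by
    refine Lp.ext ?_
    refine h2.trans ?_
    filter_upwards [Lp.coeFn_finsetSum Finset.univ fun i => (hm i).toLp,
      ae_all_iff.2 fun i => (hm i).coeFn_toLp] with ω h1 h2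
    rw [h1, Finset.sum_apply]
    exact Finset.sum_congr rfl fun i _ => (h2 i).symm
  rw [e]
  exact Submodule.sum_mem _ fun i _ => Submodule.subset_span
    ⟨n, v, _, v i, hg' i, hgc' i, (hm i).coeFn_toLp⟩

/-- For the test vector k(X(u)) h, the variable G is its divergence X(h) k - ⟨Dk, h⟩. It is square
integrable because k and its derivative are bounded. -/
theorem exists_inner_eq_of_mem_cylindricalVectors (hX : IsIsonormal X P) {W : Lp H 2 P}
    (hW : W ∈ cylindricalVectors X P) :
    ∃ G : Lp ℝ 2 P, ∀ p ∈ cylindricalPairs X P, inner ℝ p.2 W = inner ℝ p.1 G := by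
  have := hX.isProbabilityMeasure
  obtain ⟨m, u, k, h, hk, hkc, hWe⟩ := hW
  have hk1 : ContDiff ℝ 1 k := hk.of_le (by exact_mod_cast le_top)
  have hkd : Continuous (fderiv ℝ k) := hk1.continuous_fderiv (by simp)
  obtain ⟨C₂, hC₂⟩ := hkc.exists_bound_of_continuous hk.continuous
  obtain ⟨D₂, hD₂⟩ := (hkc.fderiv (𝕜 := ℝ)).exists_bound_of_continuous hkd
  have mk := hX.memLp_comp_of_bound u hk.continuous hC₂ ⊤
  have mk' : MemLp (fun ω => fderiv ℝ k (fun i => X (u i) ω) fun i => inner ℝ (u i) h) 2 P :=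
    hX.memLp_comp_of_bound u (g := fun x => fderiv ℝ k x fun i => inner ℝ (u i) h)
      (hkd.clm_apply continuous_const)
      (fun x => ((fderiv ℝ k x).le_opNorm _).trans
        (mul_le_mul_of_nonneg_right (hD₂ x) (norm_nonneg _))) 2
  have mG : MemLp (fun ω => X h ω * k (fun i => X (u i) ω) -
      fderiv ℝ k (fun i => X (u i) ω) fun i => inner ℝ (u i) h) 2 P :=
    (mk.mul (hX.memLp h (p := 2) (by simp))).sub mk'
  refine ⟨mG.toLp, ?_⟩
  rintro p ⟨n, v, g, -, hg, hgc, h1, h2⟩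
  rw [L2.inner_def, L2.inner_def]
  have key := hX.integral_fderiv_mul h v u hg hgc hk hkc
  refine Eq.trans (integral_congr_ae ?_) (key.trans (integral_congr_ae ?_))
  · filter_upwards [h2, hWe] with ω e1 e2
    rw [e1, e2, sum_inner, ← sum_fderiv_single, Finset.sum_mul]
    refine Finset.sum_congr rfl fun i _ => ?_
    rw [real_inner_smul_left, real_inner_smul_right, smul_eq_mul]
    ring
  · filter_upwards [h1, mG.coeFn_toLp] with ω e1 e2
    rw [e1, e2]
    simp [mul_comm]

/-- The Malliavin derivative is closable. -/
theorem malliavinGraph_unique (hX : IsIsonormal X P) {F : Lp ℝ 2 P} {U V : Lp H 2 P}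
    (hU : (F, U) ∈ malliavinGraph X P) (hV : (F, V) ∈ malliavinGraph X P) : U = V := by
  set M := (Submodule.span ℝ (cylindricalVectors X P)).topologicalClosure with hM
  have hmem : ∀ p ∈ malliavinGraph X P, p.2 ∈ M := by
    intro p hp
    refine closure_minimal (s := cylindricalPairs X P) (t := Prod.snd ⁻¹' (M : Set (Lp H 2 P)))
      (fun p hp => ?_) ?_ hp
    · exact Submodule.le_topologicalClosure _ (hX.snd_mem_span_of_mem_cylindricalPairs hp)
    · exact (Submodule.isClosed_topologicalClosure _).preimage continuous_snd
  have horth : ∀ W ∈ M, inner ℝ (U - V) W = 0 := by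
    intro W hW
    have hle : M ≤ LinearMap.ker (innerSL ℝ (U - V)).toLinearMap := by
      refine Submodule.topologicalClosure_minimal _ (Submodule.span_le.2 fun W hW => ?_)
        (innerSL ℝ (U - V)).isClosed_ker
      obtain ⟨G, hG⟩ := hX.exists_inner_eq_of_mem_cylindricalVectors hW
      have hG' : ∀ p ∈ malliavinGraph X P, inner ℝ p.2 W = inner ℝ p.1 G := by
        intro p hp
        refine closure_minimal (s := cylindricalPairs X P)
          (t := {p | inner ℝ p.2 W = inner ℝ p.1 G}) hG ?_ hp
        exact isClosed_eq (continuous_snd.inner continuous_const)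
          (continuous_fst.inner continuous_const)
      have h1 := hG' _ hU
      have h2 := hG' _ hV
      simp only [SetLike.mem_coe, LinearMap.mem_ker, ContinuousLinearMap.coe_coe, innerSL_apply_apply,
        inner_sub_left]
      exact sub_eq_zero.2 (h1.trans h2.symm)
    exact hle hW
  -- U - V lies in M and is orthogonal to M.
  have h0 := horth (U - V) (M.sub_mem (hmem _ hU) (hmem _ hV))
  exact sub_eq_zero.1 (inner_self_eq_zero.1 h0)

theorem malliavinDeriv_eq (hX : IsIsonormal X P) {F : Lp ℝ 2 P} {U : Lp H 2 P}
    (hU : (F, U) ∈ malliavinGraph X P) : malliavinDeriv X P F = U := by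
  have h : ∃ y, (F, y) ∈ malliavinGraph X P := ⟨U, hU⟩
  rw [malliavinDeriv, graphValue, dif_pos h]
  exact hX.malliavinGraph_unique h.choose_spec hU

end IsIsonormal

end Malliavin

/-! ## Smooth functionals with square integrable derivative -/

/-- Dilations of one bump function; the chain rule contributes a factor 1/(N+1) ≤ 1, so the
derivative bound is uniform. The value 1 is reached on a neighbourhood of each point, so that
derivatives of the truncated function stabilize too. -/
theorem exists_cutoff (n : ℕ) : ∃ (k : ℕ → (Fin n → ℝ) → ℝ) (C : ℝ),
    (∀ N, ContDiff ℝ (⊤ : ℕ∞) (k N)) ∧ (∀ N, HasCompactSupport (k N)) ∧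
    (∀ N x, |k N x| ≤ 1) ∧ (∀ N x i, |fderiv ℝ (k N) x (Pi.single i 1)| ≤ C) ∧
    ∀ x, ∀ᶠ N in Filter.atTop, k N =ᶠ[nhds x] fun _ => 1 := by
  let b : ContDiffBump (0 : Fin n → ℝ) := ⟨1, 2, by norm_num, by norm_num⟩
  have hb1 : ContDiff ℝ 1 b := b.contDiff
  obtain ⟨C, hC⟩ := (b.hasCompactSupport.fderiv (𝕜 := ℝ)).exists_bound_of_continuous
    (hb1.continuous_fderiv (by simp))
  have hc : ∀ N : ℕ, ((N : ℝ) + 1)⁻¹ ≠ 0 := fun N => by positivity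
  refine ⟨fun N x => b (((N : ℝ) + 1)⁻¹ • x), C, fun N => ?_, fun N => ?_, fun N x => ?_,
    fun N x i => ?_, fun x => ?_⟩
  · exact b.contDiff.comp (contDiff_const_smul _)
  · exact b.hasCompactSupport.comp_homeomorph (Homeomorph.smulOfNeZero _ (hc N))
  · rw [abs_of_nonneg b.nonneg]
    exact b.le_one
  · have hd : HasFDerivAt (fun x : Fin n → ℝ => b (((N : ℝ) + 1)⁻¹ • x))
        ((fderiv ℝ b (((N : ℝ) + 1)⁻¹ • x)).comp
          (((N : ℝ) + 1)⁻¹ • ContinuousLinearMap.id ℝ (Fin n → ℝ))) x :=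
      HasFDerivAt.comp (g := (b : (Fin n → ℝ) → ℝ)) x
        ((hb1.differentiable (by simp)) _).hasFDerivAt
        (((N : ℝ) + 1)⁻¹ • ContinuousLinearMap.id ℝ (Fin n → ℝ)).hasFDerivAt
    rw [hd.fderiv]
    simp only [ContinuousLinearMap.comp_apply, smul_apply,
      ContinuousLinearMap.id_apply, map_smul, smul_eq_mul, abs_mul]
    have h1 : |((N : ℝ) + 1)⁻¹| ≤ 1 := by
      rw [abs_of_nonneg (by positivity)]
      exact inv_le_one_of_one_le₀ (by linarith [Nat.cast_nonneg (α := ℝ) N])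
    have h2 : |fderiv ℝ b (((N : ℝ) + 1)⁻¹ • x) (Pi.single i 1)| ≤ C := by
      refine ((fderiv ℝ b _).le_opNorm _).trans ?_
      rw [Pi.norm_single, norm_one, mul_one]
      exact hC _
    exact (mul_le_of_le_one_left (abs_nonneg _) h1).trans h2
  · filter_upwards [Filter.eventually_ge_atTop ⌈‖x‖⌉₊] with N hN
    have hx : ‖x‖ < (N : ℝ) + 1 := by
      have : ‖x‖ ≤ N := (Nat.le_ceil _).trans (by exact_mod_cast hN)
      linarith
    have hmem : ((N : ℝ) + 1)⁻¹ • x ∈ Metric.ball (0 : Fin n → ℝ) 1 := by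
      rw [mem_ball_zero_iff, norm_smul, Real.norm_of_nonneg (by positivity),
        inv_mul_lt_iff₀ (by positivity), mul_one]
      exact hx
    have h1 := (b.eventuallyEq_one_of_mem_ball hmem)
    exact h1.comp_tendsto (continuous_const_smul ((N : ℝ) + 1)⁻¹).continuousAt

section Malliavin

variable {H Ω : Type*} [NormedAddCommGroup H] [InnerProductSpace ℝ H] [MeasurableSpace Ω]
  {P : Measure Ω} {X : H → Ω → ℝ}

namespace IsIsonormal

/-- A smooth functional belongs to the domain of the Malliavin derivative as soon as it is square
integrable together with its partial derivatives. -/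
theorem mem_malliavinGraph_of_contDiff (hX : IsIsonormal X P) {n : ℕ} (hn : 1 ≤ n)
    (v : Fin n → H) {g : (Fin n → ℝ) → ℝ} (hg : ContDiff ℝ (⊤ : ℕ∞) g)
    (m₀ : MemLp (fun ω => g fun i => X (v i) ω) 2 P)
    (m₁ : ∀ i, MemLp (fun ω => fderiv ℝ g (fun j => X (v j) ω) (Pi.single i 1)) 2 P)
    {F : Lp ℝ 2 P} {U : Lp H 2 P} (hF : F =ᵐ[P] fun ω => g fun i => X (v i) ω)
    (hU : U =ᵐ[P] fun ω => ∑ i, fderiv ℝ g (fun j => X (v j) ω) (Pi.single i 1) • v i) :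
    (F, U) ∈ malliavinGraph X P := by
  have := hX.isProbabilityMeasure
  obtain ⟨k, C, hk, hkc, hk1, hkd, hlim⟩ := exists_cutoff n
  set x : Ω → Fin n → ℝ := fun ω i => X (v i) ω with hx
  have hxm : AEStronglyMeasurable x P := (hX.aemeasurable_pi v).aestronglyMeasurable
  have hgk : ∀ N, ContDiff ℝ (⊤ : ℕ∞) fun z => k N z * g z := fun N => (hk N).mul hg
  have hfd : ∀ N z i, fderiv ℝ (fun z => k N z * g z) z (Pi.single i 1) =
      k N z * fderiv ℝ g z (Pi.single i 1) + g z * fderiv ℝ (k N) z (Pi.single i 1) := by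
    intro N z i
    rw [fderiv_fun_mul ((hk N).differentiable (by simp) z) (hg.differentiable (by simp) z)]
    simp
  -- A majorant independent of N, square integrable by assumption, for dominated convergence of the
  -- derivatives.
  have hb₁ : ∀ N ω i, |fderiv ℝ (fun z => k N z * g z) (x ω) (Pi.single i 1)| ≤
      |fderiv ℝ g (x ω) (Pi.single i 1)| + |g (x ω)| * C := by
    intro N ω i
    rw [hfd]
    refine (abs_add_le _ _).trans (add_le_add ?_ ?_)
    · rw [abs_mul]
      exact mul_le_of_le_one_left (abs_nonneg _) (hk1 N _)
    · rw [abs_mul]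
      exact mul_le_mul_of_nonneg_left (hkd N _ i) (abs_nonneg _)
  have hcont : ∀ N i, Continuous fun z => fderiv ℝ (fun z => k N z * g z) z (Pi.single i 1) :=
    fun N i => ((hgk N).continuous_fderiv (by simp)).clm_apply continuous_const
  have hB₀ : MemLp (fun ω => |g (x ω)|) 2 P := m₀.abs
  have hB₁ : MemLp (fun ω => ∑ i, (|fderiv ℝ g (x ω) (Pi.single i 1)| + |g (x ω)| * C) * ‖v i‖)
      2 P := memLp_finsetSum _ fun i _ => ((m₁ i).abs.add (hB₀.mul_const C)).mul_const _
  have hle₀ : ∀ N ω, ‖k N (x ω) * g (x ω)‖ ≤ |g (x ω)| := fun N ω => by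
    rw [Real.norm_eq_abs, abs_mul]
    exact mul_le_of_le_one_left (abs_nonneg _) (hk1 N _)
  have hle₁ : ∀ N ω, ‖∑ i, fderiv ℝ (fun z => k N z * g z) (x ω) (Pi.single i 1) • v i‖ ≤
      ∑ i, (|fderiv ℝ g (x ω) (Pi.single i 1)| + |g (x ω)| * C) * ‖v i‖ := fun N ω => by
    refine (norm_sum_le _ _).trans (Finset.sum_le_sum fun i _ => ?_)
    rw [norm_smul]
    exact mul_le_mul_of_nonneg_right (hb₁ N ω i) (norm_nonneg _)
  have hm₀ : ∀ N, MemLp (fun ω => k N (x ω) * g (x ω)) 2 P := fun N =>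
    m₀.of_le ((hgk N).continuous.comp_aestronglyMeasurable hxm)
      (Filter.Eventually.of_forall fun ω => by simpa using hle₀ N ω)
  have hm₁ : ∀ N, MemLp (fun ω =>
      ∑ i, fderiv ℝ (fun z => k N z * g z) (x ω) (Pi.single i 1) • v i) 2 P := fun N => by
    have hc : Continuous fun z =>
        ∑ i, fderiv ℝ (fun z => k N z * g z) z (Pi.single i 1) • v i :=
      continuous_finsetSum _ fun i _ => (hcont N i).smul continuous_const
    exact hB₁.of_le (hc.comp_aestronglyMeasurable hxm)
      (Filter.Eventually.of_forall fun ω => (hle₁ N ω).trans (le_abs_self _))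
  have hF' : MemLp F 2 P := Lp.memLp F
  have hU' : MemLp U 2 P := Lp.memLp U
  have t₀ := tendsto_toLp_of_dominated hm₀ hF' hB₀
    (fun N => Filter.Eventually.of_forall (hle₀ N)) (by
      filter_upwards [hF] with ω e
      rw [e]
      refine tendsto_const_nhds.congr' ?_
      filter_upwards [hlim (x ω)] with N hN
      rw [hN.eq_of_nhds, one_mul])
  have t₁ := tendsto_toLp_of_dominated hm₁ hU' hB₁
    (fun N => Filter.Eventually.of_forall (hle₁ N)) (by
      filter_upwards [hU] with ω e
      rw [e]
      refine tendsto_const_nhds.congr' ?_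
      filter_upwards [hlim (x ω)] with N hN
      have : (fun z => k N z * g z) =ᶠ[nhds (x ω)] g := by
        filter_upwards [hN] with z hz
        rw [hz, one_mul]
      rw [this.fderiv_eq])
  rw [Lp.toLp_coeFn] at t₀ t₁
  refine mem_closure_of_tendsto (t₀.prodMk_nhds t₁) (Filter.Eventually.of_forall fun N => ?_)
  exact ⟨n, v, fun z => k N z * g z, hn, hgk N, (hkc N).mul_right, (hm₀ N).coeFn_toLp,
    (hm₁ N).coeFn_toLp⟩

end IsIsonormal

theorem derivative_hermite (n : ℕ) :
    Polynomial.derivative (Polynomial.hermite n) = (n : Polynomial ℤ) * Polynomial.hermite (n - 1) := by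
  induction n with
  | zero => simp
  | succ n ih =>
    rw [Polynomial.hermite_succ, Polynomial.derivative_sub, Polynomial.derivative_mul, ih,
      Polynomial.derivative_X, one_mul, Nat.add_sub_cancel]
    rcases n with _ | n
    · simp
    · rw [Nat.add_sub_cancel, Polynomial.derivative_mul, Polynomial.derivative_natCast,
        Polynomial.hermite_succ n]
      push_cast
      ring

namespace IsIsonormal

/-- A linear combination is treated as one polynomial functional of all the X(hₖ), because
`malliavinGraph` is defined as the closure of a set and its stability under sums is not available.
-/
theorem mem_malliavinGraph_sum_hermiteVar (hX : IsIsonormal X P) {n : ℕ} (hn : 1 ≤ n) (q : ℕ)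
    (c : Fin n → ℝ) (h : Fin n → H) {F : Lp ℝ 2 P} {U : Lp H 2 P}
    (hF : F =ᵐ[P] fun ω => ∑ k, c k * hermiteVar X q (h k) ω)
    (hU : U =ᵐ[P] fun ω => ∑ k, c k • (((q : ℝ) * hermiteVar X (q - 1) (h k) ω) • h k)) :
    (F, U) ∈ malliavinGraph X P := by
  set p : MvPolynomial (Fin n) ℝ :=
    ∑ k, c k • Polynomial.aeval (MvPolynomial.X k : MvPolynomial (Fin n) ℝ) (Polynomial.hermite q)
    with hp
  have e0 : ∀ ω, MvPolynomial.eval (fun i => X (h i) ω) p = ∑ k, c k * hermiteVar X q (h k) ω := by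
    intro ω
    simp only [hp, map_sum, MvPolynomial.smul_eval, eval_aeval_X, hermiteVar]
  have e1 : ∀ i, MvPolynomial.mkDerivation ℝ
      (fun j => MvPolynomial.C ((Pi.single i 1 : Fin n → ℝ) j)) p = (c i * q) •
        Polynomial.aeval (MvPolynomial.X i : MvPolynomial (Fin n) ℝ) (Polynomial.hermite (q - 1)) := by
    intro i
    set D := MvPolynomial.mkDerivation ℝ
      (fun j => (MvPolynomial.C ((Pi.single i 1 : Fin n → ℝ) j) : MvPolynomial (Fin n) ℝ)) with hD
    have h1 : ∀ k, D (Polynomial.aeval (MvPolynomial.X k : MvPolynomial (Fin n) ℝ)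
        (Polynomial.hermite q)) = MvPolynomial.C ((Pi.single i 1 : Fin n → ℝ) k * q) *
        Polynomial.aeval (MvPolynomial.X k : MvPolynomial (Fin n) ℝ) (Polynomial.hermite (q - 1)) := by
      intro k
      have h := (D.restrictScalars ℤ).map_aeval (Polynomial.hermite q)
        (MvPolynomial.X k : MvPolynomial (Fin n) ℝ)
      rw [Derivation.restrictScalars_apply, Derivation.restrictScalars_apply,
        derivative_hermite, hD, MvPolynomial.mkDerivation_X] at h
      rw [hD, h]
      simp only [map_mul, map_natCast, smul_eq_mul]
      ring
    simp only [hp, map_sum]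
    rw [Finset.sum_eq_single i]
    · rw [Derivation.map_smul, h1, Pi.single_eq_same, one_mul, ← MvPolynomial.smul_eq_C_mul, smul_smul]
    · intro k _ hk
      rw [Derivation.map_smul, h1]
      simp [Pi.single_eq_of_ne hk]
    · simp
  have e2 : ∀ ω i, fderiv ℝ (fun x : Fin n → ℝ => MvPolynomial.eval x p) (fun j => X (h j) ω)
      (Pi.single i 1) = c i * (q * hermiteVar X (q - 1) (h i) ω) := by
    intro ω i
    rw [fderiv_eval, e1, MvPolynomial.smul_eval, eval_aeval_X, hermiteVar, mul_assoc]
  refine hX.mem_malliavinGraph_of_contDiff hn h (g := fun x => MvPolynomial.eval x p)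
    (contDiff_eval p _) (hX.memLp_polyVar h p (by simp)) (fun i => ?_)
    (hF.trans (Filter.Eventually.of_forall fun ω => (e0 ω).symm))
    (hU.trans (Filter.Eventually.of_forall fun ω => ?_))
  · simp only [e2]
    exact ((hX.memLp_hermiteVar (q - 1) (h i) (by simp)).const_mul _).const_mul _
  · simp only [e2, smul_smul]

end IsIsonormal

end Malliavin

/-! ## Closed spans and bilinear identities -/

/-- Kernels of continuous linear maps are closed subspaces, so an identity between generators
extends in one variable and then in the other. All bilinear identities below are reduced to unit
vectors this way. -/
theorem eq_zero_of_mem_closure_span {E E' W : Type*} [NormedAddCommGroup E] [NormedSpace ℝ E]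
    [NormedAddCommGroup E'] [NormedSpace ℝ E'] [NormedAddCommGroup W] [NormedSpace ℝ W]
    {S : Set E} {T : Set E'} (Φ : E → E' → W) (h₁ : ∀ t, ∃ L : E →L[ℝ] W, ∀ s, Φ s t = L s)
    (h₂ : ∀ s, ∃ L : E' →L[ℝ] W, ∀ t, Φ s t = L t) (h : ∀ s ∈ S, ∀ t ∈ T, Φ s t = 0) :
    ∀ s ∈ (Submodule.span ℝ S).topologicalClosure,
      ∀ t ∈ (Submodule.span ℝ T).topologicalClosure, Φ s t = 0 := by
  have key : ∀ s ∈ S, ∀ t ∈ (Submodule.span ℝ T).topologicalClosure, Φ s t = 0 := by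
    intro s hs t ht
    obtain ⟨L, hL⟩ := h₂ s
    have hle : (Submodule.span ℝ T).topologicalClosure ≤ LinearMap.ker L.toLinearMap :=
      Submodule.topologicalClosure_minimal _ (Submodule.span_le.2 fun t ht => by
        simpa [hL] using h s hs t ht) L.isClosed_ker
    rw [hL]
    exact hle ht
  intro s hs t ht
  obtain ⟨L, hL⟩ := h₁ t
  have hle : (Submodule.span ℝ S).topologicalClosure ≤ LinearMap.ker L.toLinearMap :=
    Submodule.topologicalClosure_minimal _ (Submodule.span_le.2 fun s hs => by
      simpa [hL] using key s hs t ht) L.isClosed_ker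
  rw [hL]
  exact hle hs

/-- The bound makes the first projection of the complete space S antilipschitz, so its range is
closed. -/
theorem exists_mem_of_mem_closure_fst {E F : Type*} [NormedAddCommGroup E] [NormedSpace ℝ E]
    [CompleteSpace E] [NormedAddCommGroup F] [NormedSpace ℝ F] [CompleteSpace F]
    (S : Submodule ℝ (E × F)) (hS : IsClosed (S : Set (E × F))) {C : ℝ}
    (hC : ∀ p ∈ S, ‖p.2‖ ≤ C * ‖p.1‖) {x : E}
    (hx : x ∈ (S.map (LinearMap.fst ℝ E F)).topologicalClosure) : ∃ y, (x, y) ∈ S := by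
  have : CompleteSpace S := hS.completeSpace_coe
  let f : S →L[ℝ] E := (ContinuousLinearMap.fst ℝ E F).comp S.subtypeL
  have hf : ∀ p : S, ‖p‖ ≤ (max 1 C).toNNReal * ‖f p‖ := by
    intro p
    rw [Real.coe_toNNReal _ (le_max_of_le_left zero_le_one)]
    change ‖(p : E × F)‖ ≤ max 1 C * ‖(p : E × F).1‖
    rw [Prod.norm_def]
    refine max_le ?_ ((hC p p.2).trans ?_)
    · exact le_mul_of_one_le_left (norm_nonneg _) (le_max_left _ _)
    · exact mul_le_mul_of_nonneg_right (le_max_right _ _) (norm_nonneg _)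
  have hcl : IsClosed (Set.range f) :=
    (ContinuousLinearMap.antilipschitz_of_bound f hf).isClosed_range f.uniformContinuous
  have hle : closure ((S.map (LinearMap.fst ℝ E F) : Submodule ℝ E) : Set E) ⊆ Set.range f := by
    refine closure_minimal ?_ hcl
    rintro _ ⟨p, hp, rfl⟩
    exact ⟨⟨p, hp⟩, rfl⟩
  obtain ⟨p, hp⟩ := hle hx
  refine ⟨(p : E × F).2, ?_⟩
  have : (x, (p : E × F).2) = (p : E × F) := Prod.ext hp.symm rfl
  rw [this]
  exact p.2

/-! ## Multiple integrals -/

section MultipleIntegral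

variable {H Ω ι : Type*} [NormedAddCommGroup H] [InnerProductSpace ℝ H] [MeasurableSpace Ω]
  {P : Measure Ω} {X : H → Ω → ℝ}

namespace IsIsonormal

theorem inner_eq_of_ae_eq_hermiteVar (hX : IsIsonormal X P) {m n : ℕ} {g h : H}
    (hg : m = 0 ∨ ‖g‖ = 1) (hh : n = 0 ∨ ‖h‖ = 1) {F G : Lp ℝ 2 P}
    (hF : F =ᵐ[P] hermiteVar X m g) (hG : G =ᵐ[P] hermiteVar X n h) :
    inner ℝ F G = if m = n then (n ! : ℝ) * inner ℝ g h ^ n else 0 := by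
  rw [L2.inner_def, ← hX.integral_hermiteVar_mul hg hh]
  refine integral_congr_ae ?_
  filter_upwards [hF, hG] with ω e1 e2
  rw [e1, e2]
  simp [mul_comm]

theorem inner_eq_zero_of_mem_chaos (hX : IsIsonormal X P) {m n : ℕ} (hmn : m ≠ n) {F G : Lp ℝ 2 P}
    (hF : F ∈ chaos X P m) (hG : G ∈ chaos X P n) : inner ℝ F G = 0 := by
  refine eq_zero_of_mem_closure_span (fun F G => inner ℝ F G)
    (fun G => ⟨innerSL ℝ G, fun F => (real_inner_comm _ _).symm⟩)
    (fun F => ⟨innerSL ℝ F, fun G => rfl⟩) ?_ F hF G hG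
  rintro F ⟨g, hg, hF⟩ G ⟨h, hh, hG⟩
  rw [hX.inner_eq_of_ae_eq_hermiteVar hg hh hF hG, if_neg hmn]

/-- On generators both sides are n!⟨g,h⟩^n. The consequences are the isometry property, hence
uniqueness of the value of I_n, and the bound needed for existence. -/
theorem inner_eq_of_mem_multipleIntegralGraph (hX : IsIsonormal X P) (e : HilbertBasis ι ℝ H)
    {n : ℕ} {s t : TensorPower ι n × Lp ℝ 2 P} (hs : s ∈ multipleIntegralGraph e X P n)
    (ht : t ∈ multipleIntegralGraph e X P n) : inner ℝ s.2 t.2 = (n ! : ℝ) * inner ℝ s.1 t.1 := by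
  rw [← sub_eq_zero]
  refine eq_zero_of_mem_closure_span
    (fun s t : TensorPower ι n × Lp ℝ 2 P => inner ℝ s.2 t.2 - (n ! : ℝ) * inner ℝ s.1 t.1)
    (fun t => ⟨(innerSL ℝ t.2).comp (ContinuousLinearMap.snd ℝ _ _) -
      (n ! : ℝ) • (innerSL ℝ t.1).comp (ContinuousLinearMap.fst ℝ _ _), fun s => ?_⟩)
    (fun s => ⟨(innerSL ℝ s.2).comp (ContinuousLinearMap.snd ℝ _ _) -
      (n ! : ℝ) • (innerSL ℝ s.1).comp (ContinuousLinearMap.fst ℝ _ _), fun t => ?_⟩)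
    ?_ s hs t ht
  · rw [real_inner_comm t.2, real_inner_comm t.1]
    rfl
  · rfl
  · rintro s ⟨g, hg, hs1, hs2⟩ t ⟨h, hh, ht1, ht2⟩
    rw [hX.inner_eq_of_ae_eq_hermiteVar hg hh hs2 ht2, if_pos rfl, hs1, ht1, inner_pureTensor]
    simp

theorem norm_sq_of_mem_multipleIntegralGraph (hX : IsIsonormal X P) (e : HilbertBasis ι ℝ H)
    {n : ℕ} {f : TensorPower ι n} {F : Lp ℝ 2 P} (h : (f, F) ∈ multipleIntegralGraph e X P n) :
    ‖F‖ ^ 2 = (n ! : ℝ) * ‖f‖ ^ 2 := by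
  have := hX.inner_eq_of_mem_multipleIntegralGraph e h h
  simpa [real_inner_self_eq_norm_sq] using this

theorem multipleIntegralGraph_unique (hX : IsIsonormal X P) (e : HilbertBasis ι ℝ H)
    {n : ℕ} {f : TensorPower ι n} {F G : Lp ℝ 2 P} (hF : (f, F) ∈ multipleIntegralGraph e X P n)
    (hG : (f, G) ∈ multipleIntegralGraph e X P n) : F = G := by
  have h1 := Submodule.sub_mem _ hF hG
  have h2 := hX.norm_sq_of_mem_multipleIntegralGraph e h1
  rw [sub_self, norm_zero] at h2
  exact sub_eq_zero.1 (norm_eq_zero.1 (by simpa using h2))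

theorem multipleIntegral_eq (hX : IsIsonormal X P) (e : HilbertBasis ι ℝ H)
    {n : ℕ} {f : TensorPower ι n} {F : Lp ℝ 2 P} (hF : (f, F) ∈ multipleIntegralGraph e X P n) :
    multipleIntegral e X P n f = F := by
  have h : ∃ y, (f, y) ∈ (multipleIntegralGraph e X P n : Set (TensorPower ι n × Lp ℝ 2 P)) :=
    ⟨F, hF⟩
  rw [multipleIntegral, graphValue, dif_pos h]
  exact hX.multipleIntegralGraph_unique e h.choose_spec hF

theorem exists_toLp (hX : IsIsonormal X P) (n : ℕ) (h : H) :
    ∃ F : Lp ℝ 2 P, F =ᵐ[P] hermiteVar X n h :=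
  ⟨(hX.memLp_hermiteVar n h (by simp)).toLp, MemLp.coeFn_toLp _⟩

theorem mem_multipleIntegralGraph (hX : IsIsonormal X P) (e : HilbertBasis ι ℝ H)
    {n : ℕ} {f : TensorPower ι n} (hf : IsSymmetric f) :
    (f, multipleIntegral e X P n f) ∈ multipleIntegralGraph e X P n := by
  have h : ∃ F, (f, F) ∈ multipleIntegralGraph e X P n := by
    refine exists_mem_of_mem_closure_fst _ (Submodule.isClosed_topologicalClosure _)
      (C := √(n ! : ℝ)) (fun p hp => ?_) ?_
    · rw [← sq_le_sq₀ (norm_nonneg _) (by positivity), mul_pow, Real.sq_sqrt (by positivity)]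
      exact (hX.norm_sq_of_mem_multipleIntegralGraph e hp).le
    · have h1 := symmetrize_mem_closure e f
      rw [symmetrize_of_isSymmetric hf] at h1
      refine Submodule.topologicalClosure_mono (Submodule.span_le.2 ?_) h1
      rintro _ ⟨h, hh, rfl⟩
      obtain ⟨F, hF⟩ := hX.exists_toLp n h
      exact ⟨(_, F), Submodule.le_topologicalClosure _ (Submodule.subset_span ⟨h, hh, rfl, hF⟩), rfl⟩
  obtain ⟨F, hF⟩ := h
  rwa [hX.multipleIntegral_eq e hF]

theorem snd_mem_chaos (e : HilbertBasis ι ℝ H) {n : ℕ}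
    {p : TensorPower ι n × Lp ℝ 2 P} (hp : p ∈ multipleIntegralGraph e X P n) :
    p.2 ∈ chaos X P n := by
  have hle : multipleIntegralGraph e X P n ≤ (chaos X P n).comap (LinearMap.snd ℝ _ _) := by
    refine Submodule.topologicalClosure_minimal _ (Submodule.span_le.2 ?_) ?_
    · rintro p ⟨h, hh, -, hp⟩
      exact Submodule.le_topologicalClosure _ (Submodule.subset_span ⟨h, hh, hp⟩)
    · exact (Submodule.isClosed_topologicalClosure _).preimage continuous_snd
  exact hle hp

/-- Chaoses of different orders are orthogonal, so only the projection onto the q-th one survives;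
it sits at summation index q - 1. -/
theorem invGenerator_of_mem_chaos (hX : IsIsonormal X P) {q : ℕ} (hq : 1 ≤ q) {F : Lp ℝ 2 P}
    (hF : F ∈ chaos X P q) : invGenerator X P F = (-(1 / (q : ℝ))) • F := by
  obtain ⟨q, rfl⟩ : ∃ k, q = k + 1 := ⟨q - 1, by omega⟩
  rw [invGenerator, tsum_eq_single q]
  · have : chaosProj X P (q + 1) F = F := Submodule.starProjection_eq_self_iff.2 hF
    rw [this]
    push_cast
    rfl
  · intro p hp
    have : chaosProj X P (p + 1) F = 0 := by
      refine (Submodule.starProjection_apply_eq_zero_iff _).2 ?_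
      rw [Submodule.mem_orthogonal]
      intro G hG
      exact hX.inner_eq_zero_of_mem_chaos (by omega) hG hF
    rw [this, smul_zero]

/-- The multiple integral of the symmetrization, as a continuous linear map. -/
noncomputable def multInt (hX : IsIsonormal X P) (e : HilbertBasis ι ℝ H) (n : ℕ) :
    TensorPower ι n →L[ℝ] Lp ℝ 2 P :=
  LinearMap.mkContinuous
    { toFun := fun f => multipleIntegral e X P n (symmetrizeL f)
      map_add' := fun f g => by
        have hm := fun f : TensorPower ι n =>
          hX.mem_multipleIntegralGraph e (isSymmetric_symmetrize f)
        simp only [symmetrizeL_apply]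
        refine hX.multipleIntegral_eq e ?_
        rw [← symmetrizeL_apply, map_add]
        simp only [symmetrizeL_apply]
        exact Submodule.add_mem _ (hm f) (hm g)
      map_smul' := fun c f => by
        have hm := fun f : TensorPower ι n =>
          hX.mem_multipleIntegralGraph e (isSymmetric_symmetrize f)
        simp only [symmetrizeL_apply, RingHom.id_apply]
        refine hX.multipleIntegral_eq e ?_
        rw [← symmetrizeL_apply, map_smul]
        simp only [symmetrizeL_apply]
        exact Submodule.smul_mem _ c (hm f) } √(n ! : ℝ) fun f => by
    simp only [LinearMap.coe_mk, AddHom.coe_mk]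
    rw [symmetrizeL_apply, ← sq_le_sq₀ (norm_nonneg _) (by positivity), mul_pow,
      Real.sq_sqrt (by positivity), hX.norm_sq_of_mem_multipleIntegralGraph e
        (hX.mem_multipleIntegralGraph e (isSymmetric_symmetrize f))]
    exact mul_le_mul_of_nonneg_left (pow_le_pow_left₀ (norm_nonneg _) (norm_symmetrize_le f) 2)
      (by positivity)

theorem multInt_apply (hX : IsIsonormal X P) (e : HilbertBasis ι ℝ H) {n : ℕ}
    (f : TensorPower ι n) : hX.multInt e n f = multipleIntegral e X P n (symmetrize f) := by
  rw [← symmetrizeL_apply]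
  rfl

theorem mem_graph_multInt (hX : IsIsonormal X P) (e : HilbertBasis ι ℝ H) {n : ℕ}
    (f : TensorPower ι n) : (symmetrize f, hX.multInt e n f) ∈ multipleIntegralGraph e X P n := by
  rw [multInt_apply]
  exact hX.mem_multipleIntegralGraph e (isSymmetric_symmetrize f)

theorem norm_sq_multInt (hX : IsIsonormal X P) (e : HilbertBasis ι ℝ H) {n : ℕ}
    (f : TensorPower ι n) : ‖hX.multInt e n f‖ ^ 2 = (n ! : ℝ) * ‖symmetrize f‖ ^ 2 :=
  hX.norm_sq_of_mem_multipleIntegralGraph e (hX.mem_graph_multInt e f)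

theorem multInt_mem_chaos (hX : IsIsonormal X P) (e : HilbertBasis ι ℝ H) {n : ℕ}
    (f : TensorPower ι n) : hX.multInt e n f ∈ chaos X P n :=
  snd_mem_chaos e (hX.mem_graph_multInt e f)

theorem multInt_pureTensor_unit (hX : IsIsonormal X P) (e : HilbertBasis ι ℝ H) {n : ℕ} {h : H}
    (hh : n = 0 ∨ ‖h‖ = 1) : hX.multInt e n (pureTensor e fun _ => h) =ᵐ[P] hermiteVar X n h := by
  obtain ⟨F, hF⟩ := hX.exists_toLp n h
  have : hX.multInt e n (pureTensor e fun _ => h) = F := by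
    rw [multInt_apply, symmetrize_of_isSymmetric (isSymmetric_pureTensor_const e h)]
    exact hX.multipleIntegral_eq e
      (Submodule.le_topologicalClosure _ (Submodule.subset_span ⟨h, hh, rfl, hF⟩))
  rw [this]
  exact hF

/-- `p(X(v₁), …, X(vₙ))` as an element of `L²`. -/
noncomputable def polyLp (hX : IsIsonormal X P) {κ : Type*} (v : κ → H) :
    MvPolynomial κ ℝ →ₗ[ℝ] Lp ℝ 2 P where
  toFun p := (hX.memLp_polyVar v p (r := 2) (by simp)).toLp
  map_add' p q := by
    rw [← MemLp.toLp_add]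
    congr 1
    funext ω
    simp [polyVar]
  map_smul' c p := by
    rw [RingHom.id_apply, ← MemLp.toLp_const_smul]
    congr 1
    funext ω
    simp [polyVar, MvPolynomial.smul_eval]

theorem coeFn_polyLp (hX : IsIsonormal X P) {κ : Type*} (v : κ → H) (p : MvPolynomial κ ℝ) :
    hX.polyLp v p =ᵐ[P] polyVar X v p :=
  (hX.memLp_polyVar v p (by simp)).coeFn_toLp

section Power

variable {κ : Type*} [Fintype κ]

theorem polyLp_creationLin_pow_unit (hX : IsIsonormal X P) (e : HilbertBasis ι ℝ H) (v : κ → H)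
    (a : κ → ℝ) {n : ℕ} (h : n = 0 ∨ ‖∑ i, a i • v i‖ = 1) :
    hX.polyLp v ((creationLin (gram v) a ^ n) 1) =
      hX.multInt e n (pureTensor e fun _ => ∑ i, a i • v i) := by
  refine Lp.ext ((hX.coeFn_polyLp v _).trans (Filter.EventuallyEq.trans ?_
    (hX.multInt_pureTensor_unit e h).symm))
  rcases h with rfl | h
  · exact Filter.Eventually.of_forall fun ω => by simp [polyVar, hermiteVar]
  have h1 : ∑ i, ∑ j, a i * a j * gram v i j = 1 := by
    have h2 : inner ℝ (∑ i, a i • v i) (∑ i, a i • v i) = (1 : ℝ) := by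
      rw [real_inner_self_eq_norm_sq, h, one_pow]
    rw [← h2, sum_inner]
    simp only [inner_sum, real_inner_smul_left, real_inner_smul_right, gram]
    exact Finset.sum_congr rfl fun i _ => Finset.sum_congr rfl fun j _ => by ring
  rw [creationLin_pow_one h1]
  filter_upwards [hX.ae_eq_sum a v] with ω hω
  rw [hermiteVar, hω, polyVar]
  have := Polynomial.hom_eval₂ (Polynomial.hermite n) (algebraMap ℤ (MvPolynomial κ ℝ))
    (MvPolynomial.eval fun i => X (v i) ω) (∑ i, a i • MvPolynomial.X i)
  rw [Polynomial.aeval_def, Polynomial.aeval_def, this]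
  congr 1
  · exact RingHom.ext_int _ _
  · simp [MvPolynomial.smul_eval]

/-- The power of creation operators is here an ordinary power of a linear form in the X(vᵢ), which
vanishes almost surely by linearity of X. -/
theorem polyLp_creationLin_pow_of_eq_zero (hX : IsIsonormal X P) (v : κ → H)
    (a : κ → ℝ) {n : ℕ} (hn : n ≠ 0) (h : ∑ i, a i • v i = 0) :
    hX.polyLp v ((creationLin (gram v) a ^ n) 1) = 0 := by
  have h1 : ∀ j, ∑ i, a i * gram v i j = 0 := by
    intro j
    have h2 : inner ℝ (∑ i, a i • v i) (v j) = (0 : ℝ) := by rw [h, inner_zero_left]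
    rw [← h2, sum_inner]
    simp only [real_inner_smul_left, gram]
  rw [creationLin_pow_one_of_deriv_eq_zero h1]
  refine Lp.ext ((hX.coeFn_polyLp v _).trans ?_)
  filter_upwards [hX.ae_eq_sum a v, hX.ae_eq_zero, Lp.coeFn_zero ℝ 2 P] with ω h2 h3 h4
  rw [h, h3] at h2
  rw [h4, polyVar]
  simp only [map_pow, map_sum, MvPolynomial.smul_eval, MvPolynomial.eval_X]
  rw [← h2]
  simp [hn]

/-- Both sides are homogeneous of degree n in a, which reduces a nonzero combination to a unit
vector. -/
theorem polyLp_creationLin_pow (hX : IsIsonormal X P) (e : HilbertBasis ι ℝ H) (v : κ → H)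
    (a : κ → ℝ) (n : ℕ) :
    hX.polyLp v ((creationLin (gram v) a ^ n) 1) =
      hX.multInt e n (pureTensor e fun _ => ∑ i, a i • v i) := by
  rcases eq_or_ne n 0 with hn | hn
  · exact hX.polyLp_creationLin_pow_unit e v a (Or.inl hn)
  rcases eq_or_ne (∑ i, a i • v i) 0 with h | h
  · rw [hX.polyLp_creationLin_pow_of_eq_zero v a hn h, h, pureTensor_zero_const e hn, map_zero]
  set c : ℝ := ‖∑ i, a i • v i‖ with hc
  have hc0 : c ≠ 0 := norm_ne_zero_iff.2 h
  have ha : a = c • (c⁻¹ • a) := by rw [smul_smul, mul_inv_cancel₀ hc0, one_smul]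
  have hs : ∀ b : κ → ℝ, ∑ i, (c • b) i • v i = c • ∑ i, b i • v i := fun b => by
    rw [Finset.smul_sum]
    exact Finset.sum_congr rfl fun i _ => by rw [Pi.smul_apply, smul_eq_mul, mul_smul]
  have hu : ‖∑ i, (c⁻¹ • a) i • v i‖ = 1 := by
    have h1 : ∑ i, (c⁻¹ • a) i • v i = c⁻¹ • ∑ i, a i • v i := by
      rw [Finset.smul_sum]
      exact Finset.sum_congr rfl fun i _ => by rw [Pi.smul_apply, smul_eq_mul, mul_smul]
    rw [h1]
    exact norm_smul_inv_norm h
  rw [ha, map_smul, smul_pow, LinearMap.smul_apply, map_smul,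
    hX.polyLp_creationLin_pow_unit e v _ (Or.inr hu), hs, pureTensor_smul_const, map_smul]

/-- Multiple integrals of elementary tensors are Wick products. -/
theorem multInt_pureTensor (hX : IsIsonormal X P) (e : HilbertBasis ι ℝ H) (v : κ → H)
    {n : ℕ} (a : Fin n → κ → ℝ) :
    hX.multInt e n (pureTensor e fun k => ∑ i, a k i • v i) =
      hX.polyLp v ((List.ofFn fun k => creationLin (gram v) (a k)).prod 1) := by
  let S : MultilinearMap ℝ (fun _ : Fin n => κ → ℝ) (Lp ℝ 2 P) :=
    ((hX.multInt e n).toLinearMap.compMultilinearMap (pureTensorM e n)).compLinearMap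
      fun _ => Fintype.linearCombination ℝ v
  let T : MultilinearMap ℝ (fun _ : Fin n => κ → ℝ) (Lp ℝ 2 P) :=
    ((hX.polyLp v ∘ₗ LinearMap.applyₗ (1 : MvPolynomial κ ℝ)).compMultilinearMap
      (MultilinearMap.mkPiAlgebraFin ℝ n (Module.End ℝ (MvPolynomial κ ℝ)))).compLinearMap
      fun _ => creationLin (gram v)
  have hS : ∀ a, S a = hX.multInt e n (pureTensor e fun k => ∑ i, a k i • v i) := fun a => by
    simp [S, Fintype.linearCombination_apply]
  have hT : ∀ a, T a = hX.polyLp v ((List.ofFn fun k => creationLin (gram v) (a k)).prod 1) :=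
    fun a => by simp [T]
  -- Both sides are multilinear in a, and symmetric: the integral because it symmetrizes its kernel,
  -- the product because creation operators commute. They agree on the diagonal, so polarization
  -- concludes.
  have key : S - T = 0 := by
    refine eq_zero_of_diagonal_eq_zero _ (fun σ x => ?_) fun x => ?_
    · rw [sub_apply, sub_apply, hS, hS, hT, hT]
      congr 1
      · rw [multInt_apply, multInt_apply, symmetrize_pureTensor_perm e σ fun k => ∑ i, x k i • v i]
      · congr 2
        refine List.Perm.prod_eq' (Equiv.Perm.ofFn_comp_perm σ
          fun k => creationLin (gram v) (x k)) ?_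
        rw [List.pairwise_ofFn]
        exact fun i j _ => creationLin_commute (gram_comm v) _ _
    · rw [sub_apply, hS, hT, ← hX.polyLp_creationLin_pow e v x n, sub_eq_zero]
      simp
  have := congrArg (fun M => M a) key
  simp only [sub_apply, zero_apply, hS, hT] at this
  exact sub_eq_zero.1 this

end Power

end IsIsonormal

end MultipleIntegral

/-! ## The derivative of a multiple integral and its squared norm -/

section Derivative

variable {H Ω ι : Type*} [NormedAddCommGroup H] [InnerProductSpace ℝ H] [MeasurableSpace Ω]
  {P : Measure Ω} {X : H → Ω → ℝ}

/-- The triples `(h^{⊗q}, H_q(X(h)), q H_{q-1}(X(h)) h)` with `‖h‖ = 1`. -/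
def hermiteTriples (e : HilbertBasis ι ℝ H) (X : H → Ω → ℝ) (P : Measure Ω) (q : ℕ) :
    Set (TensorPower ι q × Lp ℝ 2 P × Lp H 2 P) :=
  {t | ∃ h : H, ‖h‖ = 1 ∧ t.1 = pureTensor e (fun _ => h) ∧ t.2.1 =ᵐ[P] hermiteVar X q h ∧
    t.2.2 =ᵐ[P] fun ω => ((q : ℝ) * hermiteVar X (q - 1) h ω) • h}

/-- The graph of `f ↦ (I_q(f), D I_q(f))`. -/
noncomputable def derivGraph (e : HilbertBasis ι ℝ H) (X : H → Ω → ℝ) (P : Measure Ω) (q : ℕ) :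
    Submodule ℝ (TensorPower ι q × Lp ℝ 2 P × Lp H 2 P) :=
  (Submodule.span ℝ (hermiteTriples e X P q)).topologicalClosure

theorem mem_multipleIntegralGraph_of_mem_derivGraph {e : HilbertBasis ι ℝ H} {q : ℕ}
    {t : TensorPower ι q × Lp ℝ 2 P × Lp H 2 P} (ht : t ∈ derivGraph e X P q) :
    (t.1, t.2.1) ∈ multipleIntegralGraph e X P q := by
  let L : (TensorPower ι q × Lp ℝ 2 P × Lp H 2 P) →L[ℝ] (TensorPower ι q × Lp ℝ 2 P) :=
    (ContinuousLinearMap.fst ℝ _ _).prod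
      ((ContinuousLinearMap.fst ℝ _ _).comp (ContinuousLinearMap.snd ℝ _ _))
  have hle : derivGraph e X P q ≤ (multipleIntegralGraph e X P q).comap L.toLinearMap := by
    refine Submodule.topologicalClosure_minimal _ (Submodule.span_le.2 ?_) ?_
    · rintro t ⟨h, hh, h1, h2, -⟩
      exact Submodule.le_topologicalClosure _ (Submodule.subset_span ⟨h, Or.inr hh, h1, h2⟩)
    · exact (Submodule.isClosed_topologicalClosure _).preimage L.continuous
  exact hle ht

/-- The inner product as a real bilinear map. -/
noncomputable def innerBilin (H : Type*) [NormedAddCommGroup H] [InnerProductSpace ℝ H] :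
    H →L[ℝ] H →L[ℝ] ℝ :=
  LinearMap.mkContinuous₂ (innerₗ H) 1 fun x y => by
    rw [one_mul]
    exact norm_inner_le_norm x y

@[simp] theorem innerBilin_apply (x y : H) : innerBilin H x y = inner ℝ x y := rfl

/-- The expression of `⟨D I_q(f), D I_q(g)⟩` as a sum of multiple integrals. -/
noncomputable def carreDuChamp (hX : IsIsonormal X P) (e : HilbertBasis ι ℝ H) (q : ℕ) :
    TensorPower ι q →L[ℝ] TensorPower ι q →L[ℝ] Lp ℝ 2 P :=
  -- Here s contractions come from the product of two Hermite polynomials of degree q - 1, and one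
  -- more from the inner product of the derivatives, so r = s + 1.
  ∑ s ∈ Finset.range q, ((q : ℝ) ^ 2 * ((s ! : ℝ) * ((q - 1).choose s : ℝ) ^ 2)) •
    (ContinuousLinearMap.compL ℝ _ _ _ (hX.multInt e ((q - (s + 1)) + (q - (s + 1))))).comp
      (contractionL ι q q (s + 1))

theorem carreDuChamp_apply (hX : IsIsonormal X P) (e : HilbertBasis ι ℝ H) (q : ℕ)
    (f g : TensorPower ι q) : carreDuChamp hX e q f g =
      ∑ s ∈ Finset.range q, ((q : ℝ) ^ 2 * ((s ! : ℝ) * ((q - 1).choose s : ℝ) ^ 2)) •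
        hX.multInt e ((q - (s + 1)) + (q - (s + 1))) (contraction (s + 1) f g) := by
  simp [carreDuChamp]

namespace IsIsonormal

theorem mem_malliavinGraph_of_mem_derivGraph (hX : IsIsonormal X P) {e : HilbertBasis ι ℝ H} {q : ℕ}
    {t : TensorPower ι q × Lp ℝ 2 P × Lp H 2 P} (ht : t ∈ derivGraph e X P q) :
    t.2 ∈ malliavinGraph X P := by
  refine closure_minimal (t := Prod.snd ⁻¹' malliavinGraph X P) ?_
    (isClosed_closure.preimage continuous_snd) ht
  intro t ht
  obtain ⟨n, c, g, rfl⟩ := Submodule.mem_span_set'.1 ht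
  choose h hh h1 h2 h3 using fun k => (g k).2
  rcases Nat.eq_zero_or_pos n with rfl | hn
  · rw [Set.mem_preimage]
    -- Cylindrical functionals need at least one variable, so the empty combination is replaced by
    -- one with coefficient 0.
    refine hX.mem_malliavinGraph_sum_hermiteVar (n := 1) le_rfl q (fun _ => 0) (fun _ => 0) ?_ ?_
    · filter_upwards [Lp.coeFn_zero ℝ 2 P] with ω hω
      simpa using hω
    · filter_upwards [Lp.coeFn_zero H 2 P] with ω hω
      simpa using hω
  · rw [Set.mem_preimage, Prod.snd_sum]
    have e0 : (∑ k, (c k • (g k : TensorPower ι q × Lp ℝ 2 P × Lp H 2 P)).2) =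
        (∑ k, c k • (g k : TensorPower ι q × Lp ℝ 2 P × Lp H 2 P).2.1,
          ∑ k, c k • (g k : TensorPower ι q × Lp ℝ 2 P × Lp H 2 P).2.2) := by
      refine Prod.ext ?_ ?_
      · rw [Prod.fst_sum]
        rfl
      · rw [Prod.snd_sum]
        rfl
    rw [e0]
    refine hX.mem_malliavinGraph_sum_hermiteVar hn q c h ?_ ?_
    · filter_upwards [Lp.coeFn_fun_finsetSum Finset.univ fun k =>
          c k • (g k : TensorPower ι q × Lp ℝ 2 P × Lp H 2 P).2.1,
        ae_all_iff.2 fun k => Lp.coeFn_smul (c k)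
          (g k : TensorPower ι q × Lp ℝ 2 P × Lp H 2 P).2.1, ae_all_iff.2 h2] with ω a1 a2 a3
      rw [a1]
      refine Finset.sum_congr rfl fun k _ => ?_
      rw [a2, Pi.smul_apply, a3, smul_eq_mul]
    · filter_upwards [Lp.coeFn_fun_finsetSum Finset.univ fun k =>
          c k • (g k : TensorPower ι q × Lp ℝ 2 P × Lp H 2 P).2.2,
        ae_all_iff.2 fun k => Lp.coeFn_smul (c k)
          (g k : TensorPower ι q × Lp ℝ 2 P × Lp H 2 P).2.2, ae_all_iff.2 h3] with ω a1 a2 a3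
      rw [a1]
      refine Finset.sum_congr rfl fun k _ => ?_
      rw [a2, Pi.smul_apply, a3]

/-- On generators the inner product of derivatives is q²⟨g,h⟩ (q-1)!⟨g,h⟩^{q-1} = q q!⟨g,h⟩^q. -/
theorem norm_sq_deriv (hX : IsIsonormal X P) {e : HilbertBasis ι ℝ H} {q : ℕ} (hq : 1 ≤ q)
    {t : TensorPower ι q × Lp ℝ 2 P × Lp H 2 P} (ht : t ∈ derivGraph e X P q) :
    ‖t.2.2‖ ^ 2 = (q : ℝ) * (q ! : ℝ) * ‖t.1‖ ^ 2 := by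
  have key := eq_zero_of_mem_closure_span (S := hermiteTriples e X P q)
    (T := hermiteTriples e X P q)
    (fun s t => inner ℝ s.2.2 t.2.2 - ((q : ℝ) * (q ! : ℝ)) * inner ℝ s.1 t.1)
    (fun t => ⟨(innerSL ℝ t.2.2).comp ((ContinuousLinearMap.snd ℝ _ _).comp
        (ContinuousLinearMap.snd ℝ _ _)) - ((q : ℝ) * (q ! : ℝ)) •
        (innerSL ℝ t.1).comp (ContinuousLinearMap.fst ℝ _ _), fun s => by
          rw [real_inner_comm t.2.2, real_inner_comm t.1]
          rfl⟩)
    (fun s => ⟨(innerSL ℝ s.2.2).comp ((ContinuousLinearMap.snd ℝ _ _).comp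
        (ContinuousLinearMap.snd ℝ _ _)) - ((q : ℝ) * (q ! : ℝ)) •
        (innerSL ℝ s.1).comp (ContinuousLinearMap.fst ℝ _ _), fun t => rfl⟩) (by
      rintro s ⟨g, hg, s1, -, s3⟩ t ⟨h, hh, t1, -, t3⟩
      have e1 : inner ℝ s.2.2 t.2.2 = (q : ℝ) ^ 2 * inner ℝ g h *
          ∫ ω, hermiteVar X (q - 1) g ω * hermiteVar X (q - 1) h ω ∂P := by
        rw [L2.inner_def, ← integral_const_mul]
        refine integral_congr_ae ?_
        filter_upwards [s3, t3] with ω a b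
        rw [a, b, real_inner_smul_left, real_inner_smul_right]
        ring
      rw [e1, hX.integral_hermiteVar_mul (Or.inr hg) (Or.inr hh), if_pos rfl, s1, t1,
        inner_pureTensor]
      obtain ⟨m, rfl⟩ : ∃ m, q = m + 1 := ⟨q - 1, by omega⟩
      simp only [Nat.add_sub_cancel, Nat.factorial_succ, Finset.prod_const, Finset.card_univ,
        Fintype.card_fin, pow_succ]
      push_cast
      ring) t ht t ht
  rw [real_inner_self_eq_norm_sq, real_inner_self_eq_norm_sq] at key
  linarith

/-- The integral and its derivative are both bounded by √(q q!) times the norm of the kernel, and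
symmetric kernels are limits of combinations of unit powers. -/
theorem exists_mem_derivGraph [CompleteSpace H] (hX : IsIsonormal X P) (e : HilbertBasis ι ℝ H)
    {q : ℕ} (hq : 1 ≤ q) {f : TensorPower ι q} (hf : IsSymmetric f) :
    ∃ U, (f, multipleIntegral e X P q f, U) ∈ derivGraph e X P q := by
  have h : ∃ T, (f, T) ∈ derivGraph e X P q := by
    refine exists_mem_of_mem_closure_fst _ (Submodule.isClosed_topologicalClosure _)
      (C := √((q : ℝ) * (q ! : ℝ))) (fun p hp => ?_) ?_
    · have h1 := hX.norm_sq_of_mem_multipleIntegralGraph e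
        (mem_multipleIntegralGraph_of_mem_derivGraph hp)
      have h2 := hX.norm_sq_deriv hq hp
      have h3 : (1 : ℝ) ≤ q := by exact_mod_cast hq
      rw [Prod.norm_def]
      refine max_le ?_ ?_
      · rw [← sq_le_sq₀ (norm_nonneg _) (by positivity), mul_pow, Real.sq_sqrt (by positivity), h1]
        refine mul_le_mul_of_nonneg_right ?_ (sq_nonneg _)
        exact le_mul_of_one_le_left (by positivity) h3
      · rw [← sq_le_sq₀ (norm_nonneg _) (by positivity), mul_pow, Real.sq_sqrt (by positivity), h2]
    · have h1 := symmetrize_mem_closure e f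
      rw [symmetrize_of_isSymmetric hf] at h1
      refine Submodule.topologicalClosure_mono (Submodule.span_le.2 ?_) h1
      rintro _ ⟨h, hh, rfl⟩
      replace hh : ‖h‖ = 1 := hh.resolve_left (by omega)
      obtain ⟨F, hF⟩ := hX.exists_toLp q h
      have hm : MemLp (fun ω => ((q : ℝ) * hermiteVar X (q - 1) h ω) • h) 2 P := by
        have h5 := ((hX.memLp_hermiteVar (q - 1) h (r := 2) (by simp)).const_mul (q : ℝ))
        refine h5.of_le_mul (c := ‖h‖) (h5.1.smul_const h)
          (Filter.Eventually.of_forall fun ω => ?_)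
        rw [norm_smul, mul_comm]
      exact ⟨(_, F, hm.toLp), Submodule.le_topologicalClosure _
        (Submodule.subset_span ⟨h, hh, rfl, hF, hm.coeFn_toLp⟩), rfl⟩
  obtain ⟨T, hT⟩ := h
  refine ⟨T.2, ?_⟩
  rw [hX.multipleIntegral_eq e (mem_multipleIntegralGraph_of_mem_derivGraph hT)]
  exact hT

theorem multInt_pureTensor_append (hX : IsIsonormal X P) (e : HilbertBasis ι ℝ H) (h k : H)
    (m n : ℕ) :
    hX.multInt e (m + n) (pureTensor e (Fin.append (fun _ : Fin m => h) (fun _ : Fin n => k))) =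
      hX.polyLp ![h, k] ((creation (gram ![h, k]) 0 ^ m) ((creation (gram ![h, k]) 1 ^ n) 1)) := by
  have key := hX.multInt_pureTensor e ![h, k]
    (Fin.append (fun _ : Fin m => (Pi.single 0 1 : Fin 2 → ℝ)) (fun _ : Fin n => Pi.single 1 1))
  have e1 : (fun l => ∑ i, (Fin.append (fun _ : Fin m => (Pi.single 0 1 : Fin 2 → ℝ))
      (fun _ : Fin n => Pi.single 1 1) l) i • ![h, k] i) =
      Fin.append (fun _ : Fin m => h) (fun _ : Fin n => k) := by
    funext l
    refine Fin.addCases (fun l => ?_) (fun l => ?_) l <;> simp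
  have e2 : (List.ofFn fun l => creationLin (gram ![h, k])
      (Fin.append (fun _ : Fin m => (Pi.single 0 1 : Fin 2 → ℝ))
      (fun _ : Fin n => Pi.single 1 1) l)) = List.replicate m (creation (gram ![h, k]) 0) ++
        List.replicate n (creation (gram ![h, k]) 1) := by
    have : (fun l => creationLin (gram ![h, k])
      (Fin.append (fun _ : Fin m => (Pi.single 0 1 : Fin 2 → ℝ))
      (fun _ : Fin n => Pi.single 1 1) l)) = Fin.append
        (fun _ : Fin m => creation (gram ![h, k]) 0) (fun _ : Fin n => creation (gram ![h, k]) 1) := by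
      funext l
      refine Fin.addCases (fun l => ?_) (fun l => ?_) l <;> simp
    rw [this, List.ofFn_fin_append, List.ofFn_const, List.ofFn_const]
  rw [e1, e2, List.prod_append, List.prod_replicate, List.prod_replicate] at key
  exact key

/-- The product formula for Wick powers with exponent q - 1. Its s-th term carries ⟨h,k⟩^s, which
together with the outer ⟨h,k⟩ is the scalar produced by contracting s + 1 indices. -/
theorem carreDuChamp_pureTensor (hX : IsIsonormal X P) (e : HilbertBasis ι ℝ H) {q : ℕ} {h k : H}
    (hh : ‖h‖ = 1) (hk : ‖k‖ = 1) :
    carreDuChamp hX e q (pureTensor e fun _ => h) (pureTensor e fun _ => k) =ᵐ[P]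
      fun ω => (q : ℝ) ^ 2 * inner ℝ h k *
        (hermiteVar X (q - 1) h ω * hermiteVar X (q - 1) k ω) := by
  rcases Nat.eq_zero_or_pos q with rfl | hq
  · rw [carreDuChamp_apply]
    filter_upwards [Lp.coeFn_zero ℝ 2 P] with ω hω
    simpa using hω
  set v : Fin 2 → H := ![h, k] with hv
  set p : MvPolynomial (Fin 2) ℝ := ((q : ℝ) ^ 2 * inner ℝ h k) •
    ((creation (gram v) 0 ^ (q - 1)) 1 * (creation (gram v) 1 ^ (q - 1)) 1) with hp
  have e1 : carreDuChamp hX e q (pureTensor e fun _ => h) (pureTensor e fun _ => k) =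
      hX.polyLp v p := by
    rw [carreDuChamp_apply, hp, creation_pow_mul_creation_pow (gram_comm v), Finset.smul_sum,
      map_sum, Nat.sub_add_cancel hq]
    refine Finset.sum_congr rfl fun s hs => ?_
    have hs' : s + 1 ≤ q := by simpa using hs
    rw [contraction_pureTensor_const e hs' hs', map_smul, multInt_pureTensor_append, ← hv,
      smul_smul, smul_smul, map_smul, Nat.sub_sub, Nat.add_comm 1 s]
    congr 1
    have : gram v 0 1 = inner ℝ h k := rfl
    rw [this]
    ring
  rw [e1]
  refine (hX.coeFn_polyLp v p).trans (Filter.Eventually.of_forall fun ω => ?_)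
  have h0 := polyVar_creation_pow (X := X) v 0 (n := q - 1) (Or.inr (by simpa [hv] using hh)) ω
  have h1 := polyVar_creation_pow (X := X) v 1 (n := q - 1) (Or.inr (by simpa [hv] using hk)) ω
  simp only [polyVar] at h0 h1
  simp only [polyVar, hp, MvPolynomial.smul_eval, map_mul, h0, h1]
  rfl

/-- The product formula for `⟨D I_q(f), D I_q(g)⟩`. -/
theorem inner_deriv_eq_carreDuChamp (hX : IsIsonormal X P) {e : HilbertBasis ι ℝ H} {q : ℕ}
    {s t : TensorPower ι q × Lp ℝ 2 P × Lp H 2 P} (hs : s ∈ derivGraph e X P q)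
    (ht : t ∈ derivGraph e X P q) :
    (fun ω => inner ℝ (s.2.2 ω) (t.2.2 ω)) =ᵐ[P] carreDuChamp hX e q s.1 t.1 := by
  have := hX.isProbabilityMeasure
  let one : Lp ℝ 2 P := (memLp_const (1 : ℝ)).toLp
  have hone : one =ᵐ[P] fun _ => 1 := MemLp.coeFn_toLp _
  let B : Lp H 2 P →L[ℝ] Lp H 2 P →L[ℝ] Lp ℝ 1 P := (innerBilin H).holderL P 2 2 1
  -- The pointwise inner product of two elements of L²(P; H) is continuous only into L¹, so the
  -- identity is compared there; J embeds L² into L¹ as multiplication by 1.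
  let J : Lp ℝ 2 P →L[ℝ] Lp ℝ 1 P := (ContinuousLinearMap.mul ℝ ℝ).holderL P 2 2 1 one
  have hB : ∀ U V, B U V =ᵐ[P] fun ω => inner ℝ (U ω) (V ω) := fun U V =>
    (innerBilin H).coeFn_holder U V
  have hJ : ∀ G, J G =ᵐ[P] G := fun G => by
    filter_upwards [(ContinuousLinearMap.mul ℝ ℝ).coeFn_holder (r := 1) one G, hone] with ω h1 h2
    refine h1.trans ?_
    rw [h2]
    simp
  have key := eq_zero_of_mem_closure_span (S := hermiteTriples e X P q)
    (T := hermiteTriples e X P q)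
    (fun s t => B s.2.2 t.2.2 - J (carreDuChamp hX e q s.1 t.1))
    (fun t => ⟨(B.flip t.2.2).comp ((ContinuousLinearMap.snd ℝ _ _).comp
        (ContinuousLinearMap.snd ℝ _ _)) - J.comp (((carreDuChamp hX e q).flip t.1).comp
          (ContinuousLinearMap.fst ℝ _ _)), fun s => rfl⟩)
    (fun s => ⟨(B s.2.2).comp ((ContinuousLinearMap.snd ℝ _ _).comp
        (ContinuousLinearMap.snd ℝ _ _)) - J.comp ((carreDuChamp hX e q s.1).comp
          (ContinuousLinearMap.fst ℝ _ _)), fun t => rfl⟩) (by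
      rintro s ⟨g, hg, s1, -, s3⟩ t ⟨h, hh, t1, -, t3⟩
      rw [sub_eq_zero, s1, t1]
      refine Lp.ext ?_
      filter_upwards [hB s.2.2 t.2.2, hJ (carreDuChamp hX e q (pureTensor e fun _ => g)
        (pureTensor e fun _ => h)), s3, t3, hX.carreDuChamp_pureTensor e (q := q) hg hh]
        with ω a1 a2 a3 a4 a5
      rw [a1, a2, a3, a4, a5, real_inner_smul_left, real_inner_smul_right]
      ring) s hs t ht
  rw [sub_eq_zero] at key
  filter_upwards [hB s.2.2 t.2.2, hJ (carreDuChamp hX e q s.1 t.1)] with ω h1 h2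
  rw [← h1, ← h2, key]

end IsIsonormal

end Derivative

/-! ### Second moment of 1 - q⁻¹‖DF‖² -/

section SecondMoment

variable {H Ω ι : Type*} [NormedAddCommGroup H] [InnerProductSpace ℝ H] [MeasurableSpace Ω]
  {P : Measure Ω} {X : H → Ω → ℝ}

namespace IsIsonormal

theorem one_mem_chaos_zero {one : Lp ℝ 2 P} (hone : one =ᵐ[P] fun _ => 1) :
    one ∈ chaos X P 0 :=
  Submodule.le_topologicalClosure _ (Submodule.subset_span ⟨0, Or.inl rfl, by simpa using hone⟩)

/-- The chaos of order zero consists of the constants. -/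
theorem norm_sq_of_mem_chaos_zero (hX : IsIsonormal X P) {one F : Lp ℝ 2 P}
    (hone : one =ᵐ[P] fun _ => 1) (hF : F ∈ chaos X P 0) : ‖F‖ ^ 2 = inner ℝ one F ^ 2 := by
  have := hX.isProbabilityMeasure
  have hle : chaos X P 0 ≤ Submodule.span ℝ {one} := by
    refine Submodule.topologicalClosure_minimal _ (Submodule.span_mono ?_)
      (Submodule.closed_of_finiteDimensional _)
    rintro G ⟨h, -, hG⟩
    refine Lp.ext ?_
    filter_upwards [hG, hone] with ω h1 h2
    rw [h1, h2]
    simp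
  obtain ⟨c, rfl⟩ := Submodule.mem_span_singleton.1 (hle hF)
  have h1 : inner ℝ one one = (1 : ℝ) := by
    rw [L2.inner_def, integral_congr_ae (g := fun _ => (1 : ℝ))]
    · simp
    · filter_upwards [hone] with ω h
      simp [h]
  have h2 : ‖one‖ ^ 2 = 1 := by rw [← real_inner_self_eq_norm_sq, h1]
  rw [norm_smul, mul_pow, h2, real_inner_smul_right, h1, Real.norm_eq_abs, sq_abs]
  ring

/-- Pythagoras: injectivity of d puts the summands in different chaoses. -/
theorem norm_sq_sum_multInt (hX : IsIsonormal X P) (e : HilbertBasis ι ℝ H) (s : Finset ℕ)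
    (c : ℕ → ℝ) (d : ℕ → ℕ) (hd : Set.InjOn d s) (g : ∀ k, TensorPower ι (d k)) :
    ‖∑ k ∈ s, c k • hX.multInt e (d k) (g k)‖ ^ 2 =
      ∑ k ∈ s, c k ^ 2 * ((d k)! * ‖symmetrize (g k)‖ ^ 2) := by
  rw [← real_inner_self_eq_norm_sq, sum_inner]
  refine Finset.sum_congr rfl fun k hk => ?_
  rw [inner_sum, Finset.sum_eq_single k]
  · rw [real_inner_smul_left, real_inner_smul_right, real_inner_self_eq_norm_sq,
      hX.norm_sq_multInt]
    ring
  · intro l hl hlk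
    rw [real_inner_smul_left, real_inner_smul_right,
      hX.inner_eq_zero_of_mem_chaos (fun h => hlk (hd hl hk h.symm)) (hX.multInt_mem_chaos e _)
        (hX.multInt_mem_chaos e _)]
    simp
  · exact fun h => absurd hk h

theorem exists_ae_eq_one_sub (hX : IsIsonormal X P) {e : HilbertBasis ι ℝ H} {q : ℕ} (hq : 1 ≤ q)
    {t : TensorPower ι q × Lp ℝ 2 P × Lp H 2 P} (ht : t ∈ derivGraph e X P q) :
    ∃ Z : Lp ℝ 2 P, (Z =ᵐ[P] fun ω => 1 - (q : ℝ)⁻¹ * ‖t.2.2 ω‖ ^ 2) ∧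
      ‖Z‖ ^ 2 = (1 - (q ! : ℝ) * ‖t.1‖ ^ 2) ^ 2 + (q : ℝ) ^ 2 * ∑ s ∈ Finset.range (q - 1),
        ((s ! : ℝ) * ((q - 1).choose s : ℝ) ^ 2) ^ 2 * (((q - (s + 1)) + (q - (s + 1)))! *
          ‖symmetrize (contraction (s + 1) t.1 t.1)‖ ^ 2) := by
  have := hX.isProbabilityMeasure
  have hq0 : (q : ℝ) ≠ 0 := by positivity
  let one : Lp ℝ 2 P := (memLp_const (1 : ℝ)).toLp
  have hone : one =ᵐ[P] fun _ => 1 := MemLp.coeFn_toLp _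
  set f := t.1 with hf
  set a : ℕ → ℝ := fun s => (s ! : ℝ) * ((q - 1).choose s : ℝ) ^ 2 with ha
  set J : ℕ → Lp ℝ 2 P := fun s =>
    hX.multInt e ((q - (s + 1)) + (q - (s + 1))) (contraction (s + 1) f f) with hJ
  -- A gathers the terms of order zero, namely the constant 1 and the full contraction s = q - 1; B
  -- gathers the terms of positive order.
  set A : Lp ℝ 2 P := one - ((q : ℝ) * a (q - 1)) • J (q - 1) with hA
  set B : Lp ℝ 2 P := ∑ s ∈ Finset.range (q - 1), a s • J s with hB
  have hA0 : A ∈ chaos X P 0 := by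
    have h1 : J (q - 1) ∈ chaos X P 0 := by
      have h2 : J (q - 1) ∈ chaos X P ((q - ((q - 1) + 1)) + (q - ((q - 1) + 1))) :=
        hX.multInt_mem_chaos e (contraction ((q - 1) + 1) f f)
      have h3 : (q - ((q - 1) + 1)) + (q - ((q - 1) + 1)) = 0 := by omega
      rwa [h3] at h2
    exact Submodule.sub_mem _ (one_mem_chaos_zero hone) (Submodule.smul_mem _ _ h1)
  have horth : ∀ F ∈ chaos X P 0, inner ℝ F B = 0 := by
    intro F hF
    rw [hB, inner_sum]
    refine Finset.sum_eq_zero fun s hs => ?_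
    have hs' := Finset.mem_range.1 hs
    rw [real_inner_smul_right, hX.inner_eq_zero_of_mem_chaos (m := 0)
      (n := (q - (s + 1)) + (q - (s + 1))) (by omega) hF (hX.multInt_mem_chaos e _), mul_zero]
  have hZ : A - (q : ℝ) • B =ᵐ[P] fun ω => 1 - (q : ℝ)⁻¹ * ‖t.2.2 ω‖ ^ 2 := by
    have h1 : A - (q : ℝ) • B = one - (q : ℝ)⁻¹ • carreDuChamp hX e q f f := by
      have h2 : (q : ℝ)⁻¹ • carreDuChamp hX e q f f = ∑ s ∈ Finset.range q, ((q : ℝ) * a s) • J s := by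
        rw [carreDuChamp_apply, Finset.smul_sum]
        refine Finset.sum_congr rfl fun s _ => ?_
        rw [smul_smul]
        congr 1
        rw [ha]
        field_simp
      rw [h2]
      obtain ⟨m, rfl⟩ : ∃ m, q = m + 1 := ⟨q - 1, by omega⟩
      rw [Finset.sum_range_succ, hA, hB, Finset.smul_sum]
      simp only [Nat.add_sub_cancel, smul_smul]
      abel
    rw [h1]
    filter_upwards [Lp.coeFn_sub one ((q : ℝ)⁻¹ • carreDuChamp hX e q f f),
      Lp.coeFn_smul (q : ℝ)⁻¹ (carreDuChamp hX e q f f), hone,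
      hX.inner_deriv_eq_carreDuChamp ht ht] with ω b1 b2 b3 b4
    rw [b1, Pi.sub_apply, b2, b3, Pi.smul_apply, ← b4, real_inner_self_eq_norm_sq, smul_eq_mul]
  refine ⟨A - (q : ℝ) • B, hZ, ?_⟩
  have hnorm : ‖A - (q : ℝ) • B‖ ^ 2 = ‖A‖ ^ 2 + (q : ℝ) ^ 2 * ‖B‖ ^ 2 := by
    rw [norm_sub_sq_real, real_inner_smul_right, horth A hA0, norm_smul, mul_pow,
      Real.norm_eq_abs, sq_abs]
    ring
  -- A is constant, so its mean determines it. B is centered, so this is the mean of the whole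
  -- variable, known from E‖DF‖²; the full contraction need not be evaluated.
  have hmean : inner ℝ one A = 1 - (q ! : ℝ) * ‖f‖ ^ 2 := by
    have h1 : inner ℝ one A = inner ℝ one (A - (q : ℝ) • B) := by
      rw [inner_sub_right one A, real_inner_smul_right, horth one (one_mem_chaos_zero hone)]
      ring
    have h2 : ∫ ω, ‖t.2.2 ω‖ ^ 2 ∂P = ‖t.2.2‖ ^ 2 := by
      rw [← real_inner_self_eq_norm_sq, L2.inner_def]
      simp only [real_inner_self_eq_norm_sq]
    have h3 : Integrable (fun ω => ‖t.2.2 ω‖ ^ 2) P := (Lp.memLp t.2.2).norm.integrable_sq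
    rw [h1, L2.inner_def, integral_congr_ae (g := fun ω => 1 - (q : ℝ)⁻¹ * ‖t.2.2 ω‖ ^ 2)]
    · rw [integral_sub (integrable_const _) (h3.const_mul _), integral_const_mul, h2,
        hX.norm_sq_deriv hq ht]
      simp only [integral_const, probReal_univ, smul_eq_mul]
      field_simp
      rw [hf]
    · filter_upwards [hone, hZ] with ω h4 h5
      rw [h4, h5]
      simp
  rw [hnorm, hX.norm_sq_of_mem_chaos_zero hone hA0, hmean, hB,
    hX.norm_sq_sum_multInt e _ a (fun s => (q - (s + 1)) + (q - (s + 1))) ?_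
      fun s => contraction (s + 1) f f]
  -- The orders 2(q - s - 1) are distinct for s < q - 1.
  intro s hs l hl h
  have hs' : s < q - 1 := by simpa using hs
  have hl' : l < q - 1 := by simpa using hl
  simp only at h
  omega

end IsIsonormal

end SecondMoment

theorem sum_Icc_eq_sum_range {M : Type*} [AddCommMonoid M] (n : ℕ) (u : ℕ → M) :
    ∑ r ∈ Finset.Icc 1 n, u r = ∑ s ∈ Finset.range n, u (s + 1) := by
  rw [Finset.range_eq_Ico, Finset.sum_Ico_add' u 0 n 1]
  rfl

end WienerChaos

/-! ### The proposition -/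

theorem proposition3p2 {H Ω ι : Type*} [NormedAddCommGroup H] [InnerProductSpace ℝ H]
    [CompleteSpace H] [TopologicalSpace.SeparableSpace H] (e : HilbertBasis ι ℝ H)
    [MeasurableSpace Ω] (P : Measure Ω) [IsProbabilityMeasure P]
    (X : H → Ω → ℝ) (hX : WienerChaos.IsIsonormal X P)
    (q : ℕ) (hq : 2 ≤ q) (f : WienerChaos.TensorPower ι q) (hf : WienerChaos.IsSymmetric f)
    (F : Lp ℝ 2 P) (hF : F = WienerChaos.multipleIntegral e X P q f)
    (DF DLinvF : Lp H 2 P) (hDF : DF = WienerChaos.malliavinDeriv X P F)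
    (hDLinvF : DLinvF = WienerChaos.malliavinDeriv X P (WienerChaos.invGenerator X P F)) :
    -- both derivatives are well defined
    WienerChaos.MemD12 X P F ∧
    WienerChaos.MemD12 X P (WienerChaos.invGenerator X P F) ∧
    (∀ᵐ ω ∂P, inner ℝ (DF ω) (-DLinvF ω) = (q : ℝ)⁻¹ * ‖DF ω‖ ^ 2) ∧
    -- the expectations are those of integrable variables
    Integrable (fun ω => (1 - inner ℝ (DF ω) (-DLinvF ω)) ^ 2) P ∧
    Integrable (fun ω => (1 - (q : ℝ)⁻¹ * ‖DF ω‖ ^ 2) ^ 2) P ∧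
    ∫ ω, (1 - inner ℝ (DF ω) (-DLinvF ω)) ^ 2 ∂P =
      ∫ ω, (1 - (q : ℝ)⁻¹ * ‖DF ω‖ ^ 2) ^ 2 ∂P ∧
    ∫ ω, (1 - (q : ℝ)⁻¹ * ‖DF ω‖ ^ 2) ^ 2 ∂P =
      (1 - (q ! : ℝ) * ‖f‖ ^ 2) ^ 2 +
        (q : ℝ) ^ 2 * ∑ r ∈ Finset.Icc 1 (q - 1),
          ((2 * q - 2 * r)! : ℝ) * ((r - 1)! : ℝ) ^ 2 * ((q - 1).choose (r - 1) : ℝ) ^ 4 *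
            ‖WienerChaos.symmetrize (WienerChaos.contraction r f f)‖ ^ 2 ∧
    (1 - (q ! : ℝ) * ‖f‖ ^ 2) ^ 2 +
        (q : ℝ) ^ 2 * ∑ r ∈ Finset.Icc 1 (q - 1),
          ((2 * q - 2 * r)! : ℝ) * ((r - 1)! : ℝ) ^ 2 * ((q - 1).choose (r - 1) : ℝ) ^ 4 *
            ‖WienerChaos.symmetrize (WienerChaos.contraction r f f)‖ ^ 2 ≤
      (1 - (q ! : ℝ) * ‖f‖ ^ 2) ^ 2 +
        (q : ℝ) ^ 2 * ∑ r ∈ Finset.Icc 1 (q - 1),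
          ((2 * q - 2 * r)! : ℝ) * ((r - 1)! : ℝ) ^ 2 * ((q - 1).choose (r - 1) : ℝ) ^ 4 *
            ‖WienerChaos.contraction r f f‖ ^ 2 := by
  have hq1 : 1 ≤ q := by omega
  have hq0 : (q : ℝ) ≠ 0 := by positivity
  obtain ⟨U, ht⟩ := hX.exists_mem_derivGraph e hq1 hf
  rw [← hF] at ht
  have hFU := hX.mem_malliavinGraph_of_mem_derivGraph ht
  have hFc : F ∈ WienerChaos.chaos X P q := WienerChaos.IsIsonormal.snd_mem_chaos e
    (WienerChaos.mem_multipleIntegralGraph_of_mem_derivGraph ht)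
  -- Since L⁻¹F = -F/q and `derivGraph` is a subspace, the multiple of the triple of F by -1/q
  -- supplies the derivative of L⁻¹F.
  have hLU : (WienerChaos.invGenerator X P F, (-(1 / (q : ℝ))) • U) ∈
      WienerChaos.malliavinGraph X P := by
    rw [hX.invGenerator_of_mem_chaos hq1 hFc]
    exact hX.mem_malliavinGraph_of_mem_derivGraph (Submodule.smul_mem _ (-(1 / (q : ℝ))) ht)
  have hDU : DF = U := hDF.trans (hX.malliavinDeriv_eq hFU)
  have hDL : DLinvF = (-(1 / (q : ℝ))) • U := hDLinvF.trans (hX.malliavinDeriv_eq hLU)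
  subst hDU hDL
  have hinner : ∀ᵐ ω ∂P, inner ℝ (DF ω) (-((-(1 / (q : ℝ))) • DF : Lp H 2 P) ω) =
      (q : ℝ)⁻¹ * ‖DF ω‖ ^ 2 := by
    filter_upwards [Lp.coeFn_smul (-(1 / (q : ℝ))) DF] with ω h
    rw [h, Pi.smul_apply, neg_smul, neg_neg, real_inner_smul_right, real_inner_self_eq_norm_sq,
      one_div]
  obtain ⟨Z, hZ, hnorm⟩ := hX.exists_ae_eq_one_sub hq1 ht
  have hsq : (fun ω => Z ω ^ 2) =ᵐ[P] fun ω => (1 - (q : ℝ)⁻¹ * ‖DF ω‖ ^ 2) ^ 2 := by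
    filter_upwards [hZ] with ω h
    rw [h]
  have heq : (fun ω => (1 - inner ℝ (DF ω) (-((-(1 / (q : ℝ))) • DF : Lp H 2 P) ω)) ^ 2) =ᵐ[P]
      fun ω => (1 - (q : ℝ)⁻¹ * ‖DF ω‖ ^ 2) ^ 2 := by
    filter_upwards [hinner] with ω h
    rw [h]
  -- Integrability comes from the finite chaos expansion: Z is an element of L² by construction.
  have hint : Integrable (fun ω => (1 - (q : ℝ)⁻¹ * ‖DF ω‖ ^ 2) ^ 2) P :=
    ((Lp.memLp Z).integrable_sq).congr hsq
  refine ⟨⟨DF, hFU⟩, ⟨_, hLU⟩, hinner, hint.congr heq.symm, hint, integral_congr_ae heq, ?_, ?_⟩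
  · rw [← integral_congr_ae hsq]
    have h1 : ∫ ω, Z ω ^ 2 ∂P = ‖Z‖ ^ 2 := by
      rw [← real_inner_self_eq_norm_sq, L2.inner_def]
      simp [sq]
    rw [h1, hnorm, WienerChaos.sum_Icc_eq_sum_range]
    congr 2
    refine Finset.sum_congr rfl fun s hs => ?_
    have h2 : 2 * q - 2 * (s + 1) = (q - (s + 1)) + (q - (s + 1)) := by omega
    rw [h2, Nat.add_sub_cancel]
    ring
  · gcongr
    exact WienerChaos.norm_symmetrize_le _
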